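/- Let $C$ be a field of characteristic zero, let $K_0=(C(x),d/dx)$ with $x$ transcendental over $C$, and let $K_0\subset K_1\subset\cdots\subset K_n$ be a tower of differential fields with $K_i=K_{i-1}(t_i)$ and $t_i$ transcendental over $K_{i-1}$ for $1\le i\le n$; put $t_0=x$ and $K_{-1}=C$. *Proper, simple.* For $0\le i\le n$, an element of $K_i=K_{i-1}(t_i)$ is *$t_i$-proper* if the degree in $t_i$ of its numerator is lower than that of its denominator (zero is $t_i$-proper); it is *$t_i$-simple* if it is $t_i$-proper and its denominator $p\in K_{i-1}[t_i]$ satisfies $\gcd(p,p')=1$. *Decomposition.* Let $T_i$ be the monoid of power products of $t_{i+1},\dots,t_n$ (so $T_n=\{1\}$). Let $P_0=K_0[t_1,\dots,t_n]$ and, for $1\le i\le n$, let $P_i$ be the additive group of linear combinations of elements of $T_i$ with $t_i$-proper coefficients. Then $K_n=P_0\oplus\cdots\oplus P_n$; let $\pi_i:K_n\to P_i$ be the projections. An element $f\in K_n$ is *simple* if $\pi_i(f)$ is $t_i$-simple for all $0\le i\le n$. *S-primitive.* The tower is *S-primitive* if for every $1\le i\le n$: $t_i'\in K_{i-1}$,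 the fields $K_i$ and $K_{i-1}$ have the same constants, and $t_i'$ is simple. *Order.* Let $\prec$ be the purely lexicographic order on $T_0$ with $t_1\prec\cdots\prec t_n$, with $0$ added as the lowest element. Let $\mathrm{hm}_i(f)$ be the highest element of $T_i$ that appears in $\pi_i(f)$ and $\mathrm{hc}_i(f)$ its coefficient (both are $0$ if $\pi_i(f)=0$). Put $\mathrm{hm}(f)=\max_{0\le i\le n}\mathrm{hm}_i(f)$ and $\mathrm{hc}(f)=\sum_{i:\,\mathrm{hm}_i(f)=\mathrm{hm}(f)}\mathrm{hc}_i(f)$. For $f,g\in K_n$ with denominators of degrees $d_f,d_g$ in $t_n$, write $f\prec g$ if $d_f<d_g$, or $d_f=d_g$ and $\mathrm{hm}(f)\prec\mathrm{hm}(g)$. An element $r\in K_n$ is a *remainder* if it is minimal with respect to $\prec$ in its class $\{g\in K_n: g-r\in K_n'\}$, where $K_n'=\{h':h\in K_n\}$. The *indicator* of $t_1^{d_1}\cdots t_n^{d_n}$ is $\min\{i\ge 1: d_i\ne0\}$, and the indicator of $1$ is $n$. **Proposition.** Let the tower be S-primitive, let $r\in K_n$, and let $m$ be the indicator of $\mathrm{hm}(r)$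 (not needed if $r=0$). Then $r$ is a remainder if either $r=0$, or both of the following hold: $\pi_n(r)$ is $t_n$-simple, and $\mathrm{hc}(r-\pi_n(r))$ is simple and is not a nonzero element of $\mathrm{span}_C\{t_1',\dots,t_m'\}$. -/

import Mathlib

open scoped Polynomial

noncomputable section

/-- A tower of differential fields `K_0 ⊂ K_1 ⊂ ⋯ ⊂ K_n = F` over the differential field
`K_0 = (C(x), d/dx)`, where `K_i = K_{i-1}(t_i)` with `t_i` transcendental over `K_{i-1}` and
`t_i' ∈ K_i` for `1 ≤ i ≤ n`. All the fields of the tower are subfields of the largest one, `F`.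
The generators are stored together with `t_0 = x`, which is transcendental over `C` and satisfies
`x' = 1`; the derivation is `C`-linear, so it kills `C`. -/
structure DiffTower (C F : Type*) [Field C] [Field F] [Algebra C F] (n : ℕ) where
  /-- the derivation `'` of `K_n = F` -/
  D : Derivation C F F
  /-- the generators `x = t_0, t_1, …, t_n` -/
  t : Fin (n + 1) → F
  deriv_x : D (t 0) = 1
  transcendental : ∀ i, Transcendental (IntermediateField.adjoin C (t '' Set.Iio i)) (t i)
  deriv_mem : ∀ i, D (t i) ∈ IntermediateField.adjoin C (t '' Set.Iic i)
  adjoin_eq_top : IntermediateField.adjoin C (Set.range t) = ⊤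

namespace DiffTower

variable {C F : Type*} [Field C] [Field F] [Algebra C F] {n : ℕ} (T : DiffTower C F n)

/-- The field `K_i = C(t_0, …, t_i)`. -/
def K (i : Fin (n + 1)) : IntermediateField C F :=
  IntermediateField.adjoin C (T.t '' Set.Iic i)

/-- The field `C(t_0, …, t_{i-1})` over which `t_i` is adjoined: it is `K_{i-1}` if `i ≥ 1`,
and `C` if `i = 0`. -/
def below (i : Fin (n + 1)) : IntermediateField C F :=
  IntermediateField.adjoin C (T.t '' Set.Iio i)

/-- The tower is primitive: every `t_i` with `1 ≤ i ≤ n` is a primitive generator over `K_{i-1}`,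
that is, `t_i' ∈ K_{i-1}`, `t_i` is transcendental over `K_{i-1}` (part of the definition of a
tower), and `K_i = K_{i-1}(t_i)` has the same constants as `K_{i-1}`. -/
def IsPrimitive : Prop :=
  ∀ i : Fin (n + 1), i ≠ 0 →
    T.D (T.t i) ∈ T.below i ∧ ∀ c ∈ T.K i, T.D c = 0 → c ∈ T.below i

/-! ### Proper and simple elements with respect to one generator -/

/-- The value at `t_i` of a rational function over `C(t_0, …, t_{i-1})`. As `t_i` is
transcendental, this identifies the field of rational functions with `K_i`. -/
def evalAt (i : Fin (n + 1)) (g : RatFunc (T.below i)) : F :=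
  g.eval (algebraMap (T.below i) F) (T.t i)

/-- `f` is `t_i`-proper: it lies in `K_i = C(t_0, …, t_{i-1})(t_i)` and the degree in `t_i` of its
numerator is lower than that of its denominator. In particular, zero is `t_i`-proper. -/
def IsProper (i : Fin (n + 1)) (f : F) : Prop :=
  ∃ g : RatFunc (T.below i), T.evalAt i g = f ∧ g.num.degree < g.denom.degree

/-- A polynomial `p` in `t_i` is `t_i`-normal: `gcd(p, p') = 1`, where `p'` is the derivative of
`p(t_i)` in the tower, regarded again as a polynomial in `t_i`. -/
def IsNormal (i : Fin (n + 1)) (p : (T.below i)[X]) : Prop :=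
  ∃ q : (T.below i)[X], Polynomial.aeval (T.t i) q = T.D (Polynomial.aeval (T.t i) p) ∧ IsCoprime p q

/-- `f` is `t_i`-simple: it is `t_i`-proper and its denominator is `t_i`-normal. -/
def IsSimpleAt (i : Fin (n + 1)) (f : F) : Prop :=
  ∃ g : RatFunc (T.below i), T.evalAt i g = f ∧ g.num.degree < g.denom.degree ∧
    T.IsNormal i g.denom

/-! ### The matryoshka decomposition -/

/-- Power products `t_1 ^ d_1 ⋯ t_n ^ d_n`, given by their exponents (only exponents `d` with
`d 0 = 0` are used below), with the purely lexicographic order in which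
`t_1 ≺ t_2 ≺ ⋯ ≺ t_n`: of two power products the lower one is the one with the lower exponent at
the largest index where the exponents differ. -/
abbrev Mon (n : ℕ) : Type := Colex (Fin (n + 1) →₀ ℕ)

/-- The element of `F` given by a power product. -/
def monomial (M : Mon n) : F := ∏ j, T.t j ^ (ofColex M) j

/-- The value `∑ c_M M` of a linear combination of power products with coefficients in `F`. -/
def combo (c : Mon n →₀ F) : F := c.sum fun M a => a * T.monomial M

/-- The coefficients allowed in `P_i`: the elements of `K_0` if `i = 0`, and the `t_i`-proper
elements if `i ≥ 1`. -/
def IsCoef (i : Fin (n + 1)) (a : F) : Prop :=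
  if i = 0 then a ∈ T.K 0 else T.IsProper i a

/-- `c` is a linear combination of the power products in `T_i` (those free of `t_0, …, t_i`) whose
coefficients are `t_i`-proper if `i ≥ 1`, and are in `K_0` if `i = 0`. The values of these
combinations form the additive subgroup `P_i` of `K_n`. -/
def IsCombo (i : Fin (n + 1)) (c : Mon n →₀ F) : Prop :=
  (∀ M, c M ≠ 0 → ∀ j ≤ i, (ofColex M) j = 0) ∧ ∀ M, T.IsCoef i (c M)

/-- `c` displays the decomposition of `f` with respect to `K_n = P_0 ⊕ ⋯ ⊕ P_n`, each component
being written as a linear combination of power products. -/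
def IsExpansion (f : F) (c : Fin (n + 1) → Mon n →₀ F) : Prop :=
  (∀ i, T.IsCombo i (c i)) ∧ ∑ i, T.combo (c i) = f

/-! #### Existence and uniqueness of the decomposition -/

theorem below_succ (i : Fin n) : T.below i.succ = T.K i.castSucc := by
  unfold below K
  congr 2
  ext j
  simp [Fin.lt_def, Fin.le_def]

theorem below_le_K (i : Fin (n + 1)) : T.below i ≤ T.K i :=
  IntermediateField.adjoin.mono _ _ _ (Set.image_mono Set.Iio_subset_Iic_self)

theorem K_mono {i j : Fin (n + 1)} (h : i ≤ j) : T.K i ≤ T.K j :=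
  IntermediateField.adjoin.mono _ _ _ (Set.image_mono (Set.Iic_subset_Iic.2 h))

theorem K_le_below {i j : Fin (n + 1)} (h : i < j) : T.K i ≤ T.below j :=
  IntermediateField.adjoin.mono _ _ _ (Set.image_mono fun _ hk => lt_of_le_of_lt hk h)

theorem t_mem_K (i : Fin (n + 1)) : T.t i ∈ T.K i :=
  IntermediateField.subset_adjoin _ _ ⟨i, le_refl i, rfl⟩

theorem K_last : T.K (Fin.last n) = ⊤ := by
  rw [← T.adjoin_eq_top, K]
  congr 1
  ext y
  simp [Fin.le_last]

theorem transcendental_below (i : Fin (n + 1)) : Transcendental (T.below i) (T.t i) :=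
  T.transcendental i

theorem evalAt_eq (i : Fin (n + 1)) (g : RatFunc (T.below i)) :
    T.evalAt i g = Polynomial.aeval (T.t i) g.num / Polynomial.aeval (T.t i) g.denom := rfl

theorem aeval_ne_zero (i : Fin (n + 1)) {p : (T.below i)[X]} (hp : p ≠ 0) :
    Polynomial.aeval (T.t i) p ≠ 0 := fun h =>
  hp ((transcendental_iff.1 (T.transcendental_below i)) p h)

theorem evalAt_mk (i : Fin (n + 1)) (p q : (T.below i)[X]) (hq : q ≠ 0) :
    T.evalAt i (algebraMap _ (RatFunc (T.below i)) p / algebraMap _ (RatFunc (T.below i)) q) =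
      Polynomial.aeval (T.t i) p / Polynomial.aeval (T.t i) q := by
  rw [evalAt_eq, div_eq_div_iff (T.aeval_ne_zero i (RatFunc.denom_ne_zero _))
    (T.aeval_ne_zero i hq), ← map_mul, ← map_mul, (RatFunc.num_mul_eq_mul_denom_iff hq).2 rfl]

theorem isProper_iff (i : Fin (n + 1)) (f : F) : T.IsProper i f ↔
    ∃ p q : (T.below i)[X], q.Monic ∧ p.degree < q.degree ∧
      f = Polynomial.aeval (T.t i) p / Polynomial.aeval (T.t i) q := by
  constructor
  · rintro ⟨g, rfl, h⟩
    exact ⟨g.num, g.denom, RatFunc.monic_denom g, h, rfl⟩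
  · rintro ⟨p, q, hq, h, rfl⟩
    refine ⟨_, T.evalAt_mk i p q hq.ne_zero, ?_⟩
    set g := algebraMap _ (RatFunc (T.below i)) p / algebraMap _ (RatFunc (T.below i)) q
    have e : g.num * q = p * g.denom := (RatFunc.num_mul_eq_mul_denom_iff hq.ne_zero).2 rfl
    by_contra hlt
    have h1 : g.denom.degree + p.degree < g.num.degree + q.degree := by
      have hd : g.denom.degree ≠ ⊥ := by
        simpa [Polynomial.degree_eq_bot] using RatFunc.denom_ne_zero g
      calc g.denom.degree + p.degree < g.denom.degree + q.degree :=
            WithBot.add_lt_add_left hd h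
        _ ≤ _ := by gcongr; exact not_lt.1 hlt
    have h2 := congrArg Polynomial.degree e
    rw [Polynomial.degree_mul, Polynomial.degree_mul, add_comm p.degree] at h2
    exact absurd h2 h1.ne'

theorem isProper_zero (i : Fin (n + 1)) : T.IsProper i 0 :=
  (T.isProper_iff i 0).2 ⟨0, 1, Polynomial.monic_one, by simp, by simp⟩

theorem IsProper.add {T : DiffTower C F n} {i : Fin (n + 1)} {f g : F} (hf : T.IsProper i f)
    (hg : T.IsProper i g) : T.IsProper i (f + g) := by
  rw [isProper_iff] at *
  obtain ⟨p, q, hq, h, rfl⟩ := hf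
  obtain ⟨p', q', hq', h', rfl⟩ := hg
  refine ⟨p * q' + q * p', q * q', hq.mul hq', ?_, ?_⟩
  · refine lt_of_le_of_lt (Polynomial.degree_add_le _ _) (max_lt ?_ ?_)
    · rw [Polynomial.degree_mul, Polynomial.degree_mul]
      exact WithBot.add_lt_add_right (by simpa [Polynomial.degree_eq_bot] using hq'.ne_zero) h
    · rw [Polynomial.degree_mul, Polynomial.degree_mul]
      exact WithBot.add_lt_add_left (by simpa [Polynomial.degree_eq_bot] using hq.ne_zero) h'
  · rw [div_add_div _ _ (T.aeval_ne_zero i hq.ne_zero) (T.aeval_ne_zero i hq'.ne_zero)]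
    simp only [map_add, map_mul]

theorem IsProper.neg {T : DiffTower C F n} {i : Fin (n + 1)} {f : F} (hf : T.IsProper i f) :
    T.IsProper i (-f) := by
  rw [isProper_iff] at *
  obtain ⟨p, q, hq, h, rfl⟩ := hf
  exact ⟨-p, q, hq, by simpa using h, by simp [neg_div]⟩

theorem IsProper.mem {T : DiffTower C F n} {i : Fin (n + 1)} {f : F} (hf : T.IsProper i f) :
    f ∈ T.K i := by
  obtain ⟨p, q, -, -, rfl⟩ := (T.isProper_iff i f).1 hf
  have key (p : (T.below i)[X]) : Polynomial.aeval (T.t i) p ∈ T.K i := by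
    rw [Polynomial.aeval_eq_sum_range]
    refine sum_mem fun k _ => ?_
    rw [Algebra.smul_def]
    exact mul_mem (T.below_le_K i (p.coeff k).2) (pow_mem (T.t_mem_K i) k)
  exact div_mem (key p) (key q)

/-- A proper element and a polynomial add up to zero only if both vanish. -/
theorem proper_add_poly (i : Fin (n + 1)) {a : F} (ha : T.IsProper i a) {p : (T.below i)[X]}
    (h : a + Polynomial.aeval (T.t i) p = 0) : a = 0 ∧ p = 0 := by
  obtain ⟨u, q, hq, hlt, rfl⟩ := (T.isProper_iff i a).1 ha
  have hq0 := T.aeval_ne_zero i hq.ne_zero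
  rw [div_add' _ _ _ hq0, div_eq_zero_iff, or_iff_left hq0, ← map_mul, ← map_add] at h
  have h0 : u + p * q = 0 := (transcendental_iff.1 (T.transcendental_below i)) _ h
  have hp : p = 0 := by
    by_contra hp
    have h1 : q.degree ≤ (p * q).degree := Polynomial.degree_le_mul_left q hp |>.trans_eq (by
      rw [mul_comm])
    have h2 : (p * q).degree = u.degree := by
      rw [eq_neg_of_add_eq_zero_right h0, Polynomial.degree_neg]
    exact absurd hlt (not_lt.2 (h2 ▸ h1))
  subst hp
  have : u = 0 := by simpa using h0
  simp [this]

theorem mem_K_iff (i : Fin (n + 1)) {f : F} :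
    f ∈ T.K i ↔ f ∈ IntermediateField.adjoin (T.below i) {T.t i} := by
  have : T.K i = (IntermediateField.adjoin (T.below i) {T.t i}).restrictScalars C := by
    unfold below K
    rw [IntermediateField.adjoin_adjoin_left, ← Set.image_singleton, ← Set.image_union,
      Set.union_comm, Set.singleton_union, Set.Iio_insert]
  rw [this]
  rfl

/-- Every element of `K_i` is the sum of a `t_i`-proper element and a polynomial in `t_i`. -/
theorem exists_proper_add_poly (i : Fin (n + 1)) {f : F} (hf : f ∈ T.K i) :
    ∃ a, T.IsProper i a ∧ ∃ p : (T.below i)[X], f = a + Polynomial.aeval (T.t i) p := by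
  obtain ⟨p, q, rfl⟩ := (IntermediateField.mem_adjoin_simple_iff _ _).1 ((T.mem_K_iff i).1 hf)
  by_cases hq : q = 0
  · exact ⟨0, T.isProper_zero i, 0, by simp [hq]⟩
  refine ⟨Polynomial.aeval (T.t i) (p % q) / Polynomial.aeval (T.t i) q, ?_, p / q, ?_⟩
  · rw [isProper_iff]
    have hl : q.leadingCoeff ≠ 0 := by simpa using hq
    refine ⟨Polynomial.C (q.leadingCoeff⁻¹) * (p % q), Polynomial.C (q.leadingCoeff⁻¹) * q,
      ?_, ?_, ?_⟩
    · rw [mul_comm]; exact Polynomial.monic_mul_leadingCoeff_inv hq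
    · rw [Polynomial.degree_C_mul (inv_ne_zero hl), Polynomial.degree_C_mul (inv_ne_zero hl)]
      exact EuclideanDomain.mod_lt p hq
    · rw [map_mul, map_mul, mul_div_mul_left]
      exact T.aeval_ne_zero i (by simpa using hq)
  · have h0 := T.aeval_ne_zero i hq
    rw [div_add' _ _ _ h0, ← map_mul, ← map_add, mul_comm, EuclideanDomain.mod_add_div]

theorem isCoef_zero (i : Fin (n + 1)) : T.IsCoef i 0 := by
  unfold IsCoef
  split_ifs
  · exact zero_mem _
  · exact T.isProper_zero i

theorem IsCoef.add {T : DiffTower C F n} {i : Fin (n + 1)} {a b : F} (ha : T.IsCoef i a)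
    (hb : T.IsCoef i b) : T.IsCoef i (a + b) := by
  unfold IsCoef at *
  split_ifs at *
  · exact add_mem ha hb
  · exact ha.add hb

theorem IsCoef.neg {T : DiffTower C F n} {i : Fin (n + 1)} {a : F} (ha : T.IsCoef i a) :
    T.IsCoef i (-a) := by
  unfold IsCoef at *
  split_ifs at *
  · exact neg_mem ha
  · exact ha.neg

theorem IsCoef.mem {T : DiffTower C F n} {i : Fin (n + 1)} {a : F} (ha : T.IsCoef i a) :
    a ∈ T.K i := by
  unfold IsCoef at ha
  split_ifs at ha with h
  · exact h ▸ ha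
  · exact IsProper.mem ha

theorem combo_zero : T.combo 0 = 0 := Finsupp.sum_zero_index

theorem combo_add (c d : Mon n →₀ F) : T.combo (c + d) = T.combo c + T.combo d :=
  Finsupp.sum_add_index' (by simp) (by intros; ring)

theorem combo_neg (c : Mon n →₀ F) : T.combo (-c) = -T.combo c := by
  have := T.combo_add (-c) c
  rw [neg_add_cancel, combo_zero] at this
  exact eq_neg_of_add_eq_zero_left this.symm

theorem monomial_zero : T.monomial (toColex 0) = 1 := by simp [monomial]

theorem combo_single_one (a : F) : T.combo (Finsupp.single (toColex 0) a) = a := by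
  rw [combo, Finsupp.sum_single_index (by simp), monomial_zero, mul_one]

theorem isCoef_mapDomain {i : Fin (n + 1)} {c : Mon n →₀ F} (hc : ∀ M, T.IsCoef i (c M))
    (φ : Mon n → Mon n) (M : Mon n) : T.IsCoef i (Finsupp.mapDomain φ c M) := by
  classical
  rw [Finsupp.mapDomain, Finsupp.sum, Finsupp.finsetSum_apply]
  refine Finset.sum_induction _ (T.IsCoef i) (fun _ _ => IsCoef.add) (T.isCoef_zero i) ?_
  intro N _
  rw [Finsupp.single_apply]
  split_ifs
  · exact hc N
  · exact T.isCoef_zero i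

theorem exists_of_mapDomain {c : Mon n →₀ F} {φ : Mon n → Mon n} {M : Mon n}
    (h : Finsupp.mapDomain φ c M ≠ 0) : ∃ N, c N ≠ 0 ∧ φ N = M := by
  classical
  have := Finsupp.mapDomain_support (Finsupp.mem_support_iff.2 h)
  simpa using this

/-- An expansion in which only `t_1, …, t_i` occur. -/
def IsBounded (i : Fin (n + 1)) (c : Fin (n + 1) → Mon n →₀ F) : Prop :=
  (∀ j, T.IsCombo j (c j)) ∧ ∀ j M, c j M ≠ 0 → j ≤ i ∧ ∀ k, i < k → (ofColex M) k = 0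

theorem IsBounded.add {T : DiffTower C F n} {i : Fin (n + 1)} {c d : Fin (n + 1) → Mon n →₀ F}
    (hc : T.IsBounded i c) (hd : T.IsBounded i d) : T.IsBounded i (c + d) := by
  have key (j : Fin (n + 1)) (M : Mon n) (h : (c + d) j M ≠ 0) : c j M ≠ 0 ∨ d j M ≠ 0 := by
    by_contra! h'
    exact h (by simp [h'.1, h'.2])
  refine ⟨fun j => ⟨fun M h => ?_, fun M => ((hc.1 j).2 M).add ((hd.1 j).2 M)⟩, fun j M h => ?_⟩
  · exact (key j M h).elim ((hc.1 j).1 M) ((hd.1 j).1 M)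
  · exact (key j M h).elim (hc.2 j M) (hd.2 j M)

theorem IsBounded.mono {T : DiffTower C F n} {i j : Fin (n + 1)} {c : Fin (n + 1) → Mon n →₀ F}
    (hc : T.IsBounded i c) (h : i ≤ j) : T.IsBounded j c :=
  ⟨hc.1, fun l M hM => ⟨(hc.2 l M hM).1.trans h, fun k hk => (hc.2 l M hM).2 k (h.trans_lt hk)⟩⟩

theorem isBounded_single {i : Fin (n + 1)} {a : F} (ha : T.IsCoef i a) :
    T.IsBounded i (Pi.single i (Finsupp.single (toColex 0) a)) := by
  classical
  refine ⟨fun j => ?_, fun j M h => ?_⟩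
  · by_cases hj : j = i
    · subst hj
      rw [Pi.single_eq_same]
      refine ⟨fun M h => ?_, fun M => ?_⟩
      · rw [Finsupp.single_apply] at h
        split_ifs at h with h'
        · subst h'; simp
        · exact absurd rfl h
      · rw [Finsupp.single_apply]
        split_ifs
        · exact ha
        · exact T.isCoef_zero j
    · rw [Pi.single_eq_of_ne hj]
      exact ⟨fun M h => absurd rfl h, fun M => T.isCoef_zero j⟩
  · by_cases hj : j = i
    · subst hj
      rw [Pi.single_eq_same, Finsupp.single_apply] at h
      split_ifs at h with h'
      · subst h'; simp
      · exact absurd rfl h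
    · rw [Pi.single_eq_of_ne hj] at h
      exact absurd rfl h

theorem sum_combo_single (i : Fin (n + 1)) (a : F) :
    ∑ j, T.combo ((Pi.single i (Finsupp.single (toColex 0) a) : Fin (n + 1) → Mon n →₀ F) j)
      = a := by
  rw [Finset.sum_eq_single i]
  · rw [Pi.single_eq_same, combo_single_one]
  · intro j _ hj
    rw [Pi.single_eq_of_ne hj, combo_zero]
  · simp

/-- Every element of `K_i` has an expansion. -/
theorem exists_isBounded (i : Fin (n + 1)) : ∀ f ∈ T.K i, ∃ c, T.IsBounded i c ∧
    ∑ j, T.combo (c j) = f := by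
  induction i using Fin.induction with
  | zero => exact fun f hf => ⟨_, T.isBounded_single (by simpa [IsCoef] using hf),
      T.sum_combo_single 0 f⟩
  | succ i ih =>
    intro f hf
    obtain ⟨a, ha, p, rfl⟩ := T.exists_proper_add_poly i.succ hf
    suffices h : ∃ c, T.IsBounded i.succ c ∧
        ∑ j, T.combo (c j) = Polynomial.aeval (T.t i.succ) p by
      obtain ⟨c, hc, hs⟩ := h
      refine ⟨_, (T.isBounded_single (i := i.succ) (a := a) ?_).add hc, ?_⟩
      · simpa [IsCoef] using ha
      · simp only [Pi.add_apply, combo_add, Finset.sum_add_distrib, sum_combo_single, hs]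
    clear hf
    induction p using Polynomial.induction_on' with
    | add p q hp hq =>
      obtain ⟨c, hc, hs⟩ := hp
      obtain ⟨d, hd, hs'⟩ := hq
      exact ⟨c + d, hc.add hd, by
        simp only [Pi.add_apply, combo_add, Finset.sum_add_distrib, hs, hs', map_add]⟩
    | monomial k b =>
      obtain ⟨c, hc, hs⟩ := ih b (by rw [← below_succ]; exact b.2)
      refine ⟨fun j => Finsupp.mapDomain
        (fun M => toColex (ofColex M + Finsupp.single i.succ k)) (c j), ⟨fun j => ⟨?_, ?_⟩, ?_⟩, ?_⟩
      · intro M h l hl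
        obtain ⟨N, hN, rfl⟩ := exists_of_mapDomain h
        have h1 := ((hc.2 j N hN).1.trans_lt i.castSucc_lt_succ)
        simp [((hc.1 j).1 N hN l hl), (hl.trans_lt h1).ne]
      · exact T.isCoef_mapDomain (hc.1 j).2 _
      · intro j M h
        obtain ⟨N, hN, rfl⟩ := exists_of_mapDomain h
        refine ⟨(hc.2 j N hN).1.trans i.castSucc_lt_succ.le, fun l hl => ?_⟩
        simp [(hc.2 j N hN).2 l (i.castSucc_lt_succ.trans hl), hl.ne']
      · rw [Polynomial.aeval_monomial, IntermediateField.algebraMap_apply, ← hs, Finset.sum_mul]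
        refine Finset.sum_congr rfl fun j _ => ?_
        rw [combo, Finsupp.sum_mapDomain_index (by simp) (by intros; ring), combo, Finsupp.sum_mul]
        refine Finsupp.sum_congr fun M _ => ?_
        rw [mul_assoc]
        congr 1
        simp only [monomial, ofColex_toColex, Finsupp.add_apply, pow_add, Finset.prod_mul_distrib]
        congr 1
        rw [Finset.prod_eq_single i.succ]
        · simp
        · intro l _ hl; simp [hl]
        · simp

/-- The part of a combination in which the exponent of `t_i` is `k`, divided by `t_i ^ k`. -/
def slice (i : Fin (n + 1)) (k : ℕ) (c : Mon n →₀ F) : Mon n →₀ F :=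
  Finsupp.mapDomain (fun M => toColex ((ofColex M).erase i))
    (c.filter fun M => (ofColex M) i = k)

theorem combo_slice (i : Fin (n + 1)) (k : ℕ) (c : Mon n →₀ F) :
    T.combo (slice i k c) = ∑ M ∈ c.support with (ofColex M) i = k,
      c M * T.monomial (toColex ((ofColex M).erase i)) := by
  rw [slice, combo, Finsupp.sum_mapDomain_index (by simp) (by intros; ring),
    Finsupp.sum_filter_index, Finsupp.support_filter]

theorem monomial_split (i : Fin (n + 1)) (M : Mon n) : T.monomial M =
    T.monomial (toColex ((ofColex M).erase i)) * T.t i ^ (ofColex M) i := by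
  simp only [monomial, ofColex_toColex]
  rw [← Finset.mul_prod_erase _ _ (Finset.mem_univ i),
    ← Finset.mul_prod_erase _ (fun j => T.t j ^ ((ofColex M).erase i) j) (Finset.mem_univ i),
    Finsupp.erase_same, pow_zero, one_mul, mul_comm]
  congr 1
  refine Finset.prod_congr rfl fun j hj => ?_
  rw [Finsupp.erase_ne (Finset.ne_of_mem_erase hj)]

theorem combo_eq_sum_slice (i : Fin (n + 1)) (c : Mon n →₀ F) (N : ℕ)
    (hN : ∀ M, c M ≠ 0 → (ofColex M) i < N) :
    T.combo c = ∑ k ∈ Finset.range N, T.combo (slice i k c) * T.t i ^ k := by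
  rw [combo, Finsupp.sum, ← Finset.sum_fiberwise_of_maps_to (s := c.support)
    (t := Finset.range N) (g := fun M => (ofColex M) i)
    (fun M hM => Finset.mem_range.2 (hN M (Finsupp.mem_support_iff.1 hM)))]
  refine Finset.sum_congr rfl fun k _ => ?_
  rw [combo_slice, Finset.sum_mul]
  refine Finset.sum_congr rfl fun M hM => ?_
  rw [T.monomial_split i M, (Finset.mem_filter.1 hM).2, mul_assoc]

theorem slice_ne_zero {i : Fin (n + 1)} {k : ℕ} {c : Mon n →₀ F} {M : Mon n}
    (h : slice i k c M ≠ 0) :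
    ∃ N, c N ≠ 0 ∧ (ofColex N) i = k ∧ toColex ((ofColex N).erase i) = M := by
  classical
  obtain ⟨N, hN, rfl⟩ := exists_of_mapDomain h
  rw [Finsupp.filter_apply] at hN
  split_ifs at hN with hk
  · exact ⟨N, hN, hk, rfl⟩
  · exact absurd rfl hN

theorem slice_apply (i : Fin (n + 1)) (c : Mon n →₀ F) (M : Mon n) :
    slice i ((ofColex M) i) c (toColex ((ofColex M).erase i)) = c M := by
  rw [slice, Finsupp.mapDomain_apply' {N | (ofColex N) i = (ofColex M) i}
    (f := fun M : Mon n => toColex ((ofColex M).erase i)) (a := M)]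
  · exact Finsupp.filter_apply_pos _ _ rfl
  · intro N hN
    rw [Finset.mem_coe, Finsupp.support_filter] at hN
    exact (Finset.mem_filter.1 hN).2
  · intro N hN N' hN' h
    have h' : (ofColex N).erase i = (ofColex N').erase i := h
    change ofColex N = ofColex N'
    ext j
    by_cases hj : j = i
    · subst hj
      exact (hN : _ = _).trans (hN' : _ = _).symm
    · have := DFunLike.congr_fun h' j
      rwa [Finsupp.erase_ne hj, Finsupp.erase_ne hj] at this
  · rfl

theorem IsBounded.mem {T : DiffTower C F n} {i : Fin (n + 1)} {c : Fin (n + 1) → Mon n →₀ F}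
    (hc : T.IsBounded i c) : ∑ j, T.combo (c j) ∈ T.K i := by
  refine sum_mem fun j _ => sum_mem fun M hM => ?_
  have hM' := hc.2 j M (Finsupp.mem_support_iff.1 hM)
  refine mul_mem (T.K_mono hM'.1 ((hc.1 j).2 M).mem) (prod_mem fun k _ => ?_)
  by_cases hk : k ≤ i
  · exact pow_mem (T.K_mono hk (T.t_mem_K k)) _
  · rw [hM'.2 k (not_le.1 hk), pow_zero]
    exact one_mem _

theorem combo_of_forall_eq {c : Mon n →₀ F} (h : ∀ M, c M ≠ 0 → M = toColex 0) :
    T.combo c = c (toColex 0) := by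
  have : c = Finsupp.single (toColex 0) (c (toColex 0)) := by
    classical
    ext M
    rw [Finsupp.single_apply]
    split_ifs with h'
    · rw [h']
    · by_contra h''
      exact h' (h M h'').symm
  conv_lhs => rw [this]
  rw [combo_single_one]

/-- Only the zero expansion has value zero. -/
theorem IsBounded.eq_zero {T : DiffTower C F n} (i : Fin (n + 1)) :
    ∀ c : Fin (n + 1) → Mon n →₀ F, T.IsBounded i c → ∑ j, T.combo (c j) = 0 → c = 0 := by
  induction i using Fin.induction with
  | zero =>
    intro c hc hs
    have h0 (j : Fin (n + 1)) (hj : j ≠ 0) : c j = 0 := by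
      ext M
      by_contra h
      exact hj (Fin.le_zero_iff.1 (hc.2 j M h).1)
    have h1 (M : Mon n) (h : c 0 M ≠ 0) : M = toColex 0 := by
      change ofColex M = 0
      ext k
      rcases eq_zero_or_pos k with rfl | hk
      · exact (hc.1 0).1 M h 0 le_rfl
      · exact (hc.2 0 M h).2 k hk
    rw [Finset.sum_eq_single 0 (fun j _ hj => by rw [h0 j hj, combo_zero]) (by simp),
      T.combo_of_forall_eq h1] at hs
    funext j
    by_cases hj : j = 0
    · subst hj
      ext M
      by_contra h
      have := h1 M h
      subst this
      exact h hs
    · exact h0 j hj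
  | succ i ih =>
    intro c hc hs
    have h1 (M : Mon n) (h : c i.succ M ≠ 0) : M = toColex 0 := by
      change ofColex M = 0
      ext k
      rcases le_or_gt k i.succ with hk | hk
      · exact (hc.1 _).1 M h k hk
      · exact (hc.2 _ M h).2 k hk
    obtain ⟨N, hN⟩ : ∃ N, ∀ j M, c j M ≠ 0 → (ofColex M) i.succ < N := by
      refine ⟨(Finset.univ.sup fun j => (c j).support.sup fun M => (ofColex M) i.succ) + 1,
        fun j M h => Nat.lt_succ_of_le ?_⟩
      refine le_trans ?_ (Finset.le_sup (f := fun j => (c j).support.sup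
        fun M => (ofColex M) i.succ) (Finset.mem_univ j))
      exact Finset.le_sup (f := fun M : Mon n => (ofColex M) i.succ)
        (Finsupp.mem_support_iff.2 h)
    set d : ℕ → Fin (n + 1) → Mon n →₀ F := fun k j =>
      if j ≤ i.castSucc then slice i.succ k (c j) else 0 with hd
    have hdb (k : ℕ) : T.IsBounded i.castSucc (d k) := by
      have key (j : Fin (n + 1)) (M : Mon n) (h : d k j M ≠ 0) : j ≤ i.castSucc ∧
          ∃ N, c j N ≠ 0 ∧ toColex ((ofColex N).erase i.succ) = M := by
        simp only [hd] at h
        split_ifs at h with hj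
        · obtain ⟨N, h1, -, h2⟩ := slice_ne_zero h
          exact ⟨hj, N, h1, h2⟩
        · exact absurd rfl h
      refine ⟨fun j => ⟨fun M h l hl => ?_, fun M => ?_⟩, fun j M h => ?_⟩
      · obtain ⟨hj, N, hN, rfl⟩ := key j M h
        have : l ≠ i.succ := ((hl.trans hj).trans_lt i.castSucc_lt_succ).ne
        simp [Finsupp.erase_ne this, (hc.1 j).1 N hN l hl]
      · simp only [hd]
        split_ifs
        · refine T.isCoef_mapDomain (fun M => ?_) _ M
          classical
          rw [Finsupp.filter_apply]
          split_ifs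
          · exact (hc.1 j).2 M
          · exact T.isCoef_zero j
        · exact T.isCoef_zero j
      · obtain ⟨hj, N, hN, rfl⟩ := key j M h
        refine ⟨hj, fun l hl => ?_⟩
        by_cases hl' : l = i.succ
        · subst hl'; simp
        · have : i.succ < l := lt_of_le_of_ne (Fin.castSucc_lt_iff_succ_le.1 hl) (Ne.symm hl')
          simp [Finsupp.erase_ne hl', (hc.2 j N hN).2 l this]
    have hcj (j : Fin (n + 1)) : T.combo (c j) = (if j = i.succ then c i.succ (toColex 0) else 0) +
        ∑ k ∈ Finset.range N, T.combo (d k j) * T.t i.succ ^ k := by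
      rcases lt_trichotomy j i.succ with hj | hj | hj
      · rw [if_neg hj.ne, zero_add, T.combo_eq_sum_slice i.succ (c j) N (hN j)]
        simp only [hd, if_pos (Fin.le_castSucc_iff.2 hj)]
      · subst hj
        rw [if_pos rfl, T.combo_of_forall_eq h1]
        simp [hd, combo_zero]
      · have : c j = 0 := by
          ext M
          by_contra h
          exact absurd (hc.2 j M h).1 (not_le.2 hj)
        rw [this, if_neg hj.ne']
        simp [hd, combo_zero, not_le.2 (i.castSucc_lt_succ.trans hj)]
    have hv (k : ℕ) : ∑ j, T.combo (d k j) ∈ T.below i.succ := by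
      rw [below_succ]
      exact (hdb k).mem
    have hprop : T.IsProper i.succ (c i.succ (toColex 0)) := by
      have := (hc.1 i.succ).2 (toColex 0)
      simpa [IsCoef] using this
    obtain ⟨ha, hp⟩ := T.proper_add_poly i.succ hprop
      (p := ∑ k ∈ Finset.range N, Polynomial.monomial k ⟨_, hv k⟩) (by
        rw [map_sum]
        simp only [Polynomial.aeval_monomial, IntermediateField.algebraMap_apply]
        rw [← hs]
        simp only [hcj, Finset.sum_add_distrib, Finset.sum_mul]
        rw [Finset.sum_comm]
        simp)
    have hdz (k : ℕ) (hk : k < N) : d k = 0 := by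
      refine ih _ (hdb k) ?_
      have := congrArg (fun q => (q.coeff k : F)) hp
      simpa [Polynomial.finsetSum_coeff, Polynomial.coeff_monomial, hk] using this
    funext j
    ext M
    by_contra h
    by_cases hj : j = i.succ
    · subst hj
      have := h1 M h
      subst this
      exact h ha
    · have hj' : j ≤ i.castSucc := Fin.le_castSucc_iff.2 (lt_of_le_of_ne (hc.2 j M h).1 hj)
      have := hdz _ (hN j M h)
      have := congrFun this j
      simp only [hd, if_pos hj'] at this
      have := DFunLike.congr_fun this (toColex ((ofColex M).erase i.succ))
      rw [slice_apply] at this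
      exact h this

/-- `K_n` is the direct sum of `P_0, …, P_n`, and the elements of `P_i` are written uniquely as
linear combinations of power products. -/
theorem existsUnique_isExpansion (f : F) : ∃! c, T.IsExpansion f c := by
  obtain ⟨c, hc, hs⟩ := T.exists_isBounded (Fin.last n) f (by rw [K_last]; trivial)
  have last (c : Fin (n + 1) → Mon n →₀ F) (hc : ∀ j, T.IsCombo j (c j)) :
      T.IsBounded (Fin.last n) c :=
    ⟨hc, fun j M _ => ⟨Fin.le_last j, fun k hk => absurd hk (not_lt.2 (Fin.le_last k))⟩⟩
  refine ⟨c, ⟨hc.1, hs⟩, fun d hd => ?_⟩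
  have hneg : T.IsBounded (Fin.last n) (-c) := last _ fun j =>
    ⟨fun M h => (hc.1 j).1 M fun h' => h (by simp [h']), fun M => ((hc.1 j).2 M).neg⟩
  have := IsBounded.eq_zero _ _ ((last d hd.1).add hneg) (by
    simp only [Pi.add_apply, Pi.neg_apply, combo_add, combo_neg, Finset.sum_add_distrib,
      Finset.sum_neg_distrib, hs, hd.2, add_neg_cancel])
  rwa [← sub_eq_add_neg, sub_eq_zero] at this

/-- `K_n` is the field of rational functions in `t_n` over `C(t_0, …, t_{n-1})`. -/
theorem existsUnique_evalAt_last (f : F) : ∃! g, T.evalAt (Fin.last n) g = f := by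
  obtain ⟨p, q, h⟩ := (IntermediateField.mem_adjoin_simple_iff _ _).1
    ((T.mem_K_iff (Fin.last n) (f := f)).1 (by rw [K_last]; trivial))
  have hex : ∃ g, T.evalAt (Fin.last n) g = f := by
    by_cases hq : q = 0
    · exact ⟨0, by rw [h, hq]; simp [evalAt]⟩
    · exact ⟨_, (T.evalAt_mk _ p q hq).trans h.symm⟩
  obtain ⟨g, hg⟩ := hex
  refine ⟨g, hg, fun g' hg' => ?_⟩
  have e := hg'.trans hg.symm
  rw [evalAt_eq, evalAt_eq, div_eq_div_iff (T.aeval_ne_zero _ (RatFunc.denom_ne_zero _))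
    (T.aeval_ne_zero _ (RatFunc.denom_ne_zero _)), ← map_mul, ← map_mul] at e
  have e' : g'.num * g.denom = g.num * g'.denom :=
    (transcendental_iff_injective.1 (T.transcendental_below _)) e
  rw [RatFunc.num_mul_eq_mul_denom_iff (RatFunc.denom_ne_zero g), RatFunc.num_div_denom] at e'
  exact e'

/-- The (unique) expansion of `f`: `T.expansion f i` is the `i`-th projection of `f` viewed as a
polynomial in `t_{i+1}, …, t_n` with coefficients in `K_i`. -/
def expansion (f : F) : Fin (n + 1) → Mon n →₀ F :=
  (T.existsUnique_isExpansion f).choose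

/-- The `i`-th projection `π_i(f) ∈ P_i`. -/
def proj (i : Fin (n + 1)) (f : F) : F := T.combo (T.expansion f i)

/-- `f` is simple: `π_i(f)` is `t_i`-simple for all `0 ≤ i ≤ n`, where `t_0 = x`. -/
def IsSimple (f : F) : Prop := ∀ i, T.IsSimpleAt i (T.proj i f)

/-- The tower is S-primitive: it is primitive, and `t_i'` is simple for `1 ≤ i ≤ n`. -/
def IsSPrimitive : Prop :=
  T.IsPrimitive ∧ ∀ i : Fin (n + 1), i ≠ 0 → T.IsSimple (T.D (T.t i))

/-! ### Head monomials, head coefficients, and remainders -/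

/-- The `i`-th head monomial of `f`: the highest power product in `π_i(f)`, and zero, which is
represented by `⊥`, if `π_i(f) = 0`. -/
def hmAt (i : Fin (n + 1)) (f : F) : WithBot (Mon n) := (T.expansion f i).support.max

/-- The `i`-th head coefficient of `f`: the coefficient of the `i`-th head monomial in `π_i(f)`,
and zero if `π_i(f) = 0`. -/
def hcAt (i : Fin (n + 1)) (f : F) : F :=
  match T.hmAt i f with
  | ⊥ => 0
  | (M : Mon n) => T.expansion f i M

/-- The head monomial of `f`: the highest of the `i`-th head monomials, where zero (`⊥`) is the
lowest one. -/
def hm (f : F) : WithBot (Mon n) := Finset.univ.sup fun i => T.hmAt i f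

open Classical in
/-- The head coefficient of `f`: the sum of the `i`-th head coefficients over those `i` for which
the `i`-th head monomial is the head monomial. -/
def hc (f : F) : F := ∑ i with T.hmAt i f = T.hm f, T.hcAt i f

/-- The indicator of a power product: the smallest `i` such that `t_i` divides it, and `n` if it
is `1`. The value at zero (`⊥`) is irrelevant. -/
def ind : WithBot (Mon n) → Fin (n + 1)
  | ⊥ => Fin.last n
  | (M : Mon n) =>
    if h : (ofColex M).support.Nonempty then (ofColex M).support.min' h else Fin.last n

/-- The degree in `t_n` of the denominator of `f ∈ K_n = C(t_0, …, t_{n-1})(t_n)`. -/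
def denomDegree (f : F) : ℕ :=
  (T.existsUnique_evalAt_last f).choose.denom.natDegree

/-- `f ≺ g`: `f` is lower than `g`. -/
def Lower (f g : F) : Prop :=
  T.denomDegree f < T.denomDegree g ∨
    (T.denomDegree f = T.denomDegree g ∧ T.hm f < T.hm g)

/-- The class `R_f` of `f` modulo the integrable subspace `K_n' = {h' | h ∈ K_n}`. -/
def congrClass (f : F) : Set F := {g | ∃ h, g - f = T.D h}

/-- `r` is a remainder of `f`: a minimal element of `R_f` with respect to `≺`. -/
def IsRemainderOf (r f : F) : Prop :=
  r ∈ T.congrClass f ∧ ∀ g ∈ T.congrClass f, ¬ T.Lower g r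

/-- `r` is a remainder: it is a remainder of itself. -/
def IsRemainder (r : F) : Prop := T.IsRemainderOf r r

end DiffTower

end

/-!
Let `h = q + p(t_n)`, where `q` is `t_n`-proper and `p` is a polynomial, and suppose that `r + h'`
is lower than `r`. Write `r = s + w(t_n)` with `s = π_n(r)` proper and `w` a polynomial.

*Denominators.* In a primitive tower every irreducible polynomial in `t_n` is normal, so
differentiation raises the order of every pole of `q` by one (Hermite reduction). The denominator
of `s` is squarefree, hence it divides that of `s + q'`, and the two are associated only if `q = 0`
(`DiffTower.denomDegree_add_D`). So `q = 0`, and `r + h'` is lower than `r` because its head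
monomial is.

*Head coefficients.* Let `M` be the head monomial of `r`. If `w = 0`, then `M = 1`, so that
`r + h' = 0` and the proper part `r` of this sum is zero. Otherwise `M` is the head monomial of
`w(t_n)`, because `s` contributes to the power product `1` only. The coefficients of `w(t_n)` and of
`p(t_n)'` at all power products from `M` on are then opposite to each other. Hence `M` is the
highest power product in `p(t_n)'`, with coefficient `-hc(w(t_n))`, which is nonzero and simple.
By `DiffTower.coef_D_mem_span`, a simple head coefficient of a derivative lies in the span of
`t_1', …, t_m'`, where `m` is the indicator of `M`, against the hypothesis. That lemma goes down the
tower, one generator `t_i` at a time: if the derivative of `∑ p_k t_i ^ k` has degree `d` in `t_i`,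
its leading coefficient is `p_d' + (d + 1) p_{d+1} t_i'`, and `p_{d+1}` is a constant, that is, an
element of `C`.

Two notions keep this linear. `DiffTower.coef M f` adds up the coefficients of `M` over all
components of the decomposition of `f`: it is additive in `f`, it is the head coefficient when `M`
is the head monomial, and no cancellation occurs in the sum
(`DiffTower.expansion_eq_zero_of_coef`). `DiffTower.IsSquarefree` replaces normal denominators by
squarefree ones.
-/

noncomputable section

open Polynomial

/-! ### Squarefree polynomials and Hermite reduction -/

theorem Squarefree.dvd_of_forall_irreducible {k : Type*} [Field k] {b f : k[X]}
    (hb : Squarefree b) (hf : f ≠ 0) (h : ∀ P, Irreducible P → P ∣ b → P ∣ f) : b ∣ f := by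
  classical
  have h1 : UniqueFactorizationMonoid.radical b ∣ f := by
    rw [UniqueFactorizationMonoid.radical_dvd_iff_primeFactors_subset hf]
    intro P hP
    rw [UniqueFactorizationMonoid.mem_primeFactors] at hP ⊢
    have hirr := UniqueFactorizationMonoid.irreducible_of_normalized_factor P hP
    obtain ⟨Q, hQ, hPQ⟩ := UniqueFactorizationMonoid.exists_mem_normalizedFactors_of_dvd hf hirr
      (h P hirr (UniqueFactorizationMonoid.dvd_of_mem_normalizedFactors hP))
    have : P = Q := by
      rw [← UniqueFactorizationMonoid.normalize_normalized_factor P hP,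
        ← UniqueFactorizationMonoid.normalize_normalized_factor Q hQ]
      exact normalize_eq_normalize_iff.2 ⟨hPQ.dvd, hPQ.symm.dvd⟩
    rwa [this]
  exact (hb.isRadical.dvd_radical hb.ne_zero).trans h1

section Hermite

variable {k : Type*} [Field k] [CharZero k] {δ : Derivation ℤ k[X] k[X]}
  {a b u v e f : k[X]}

/-- Cleared of denominators, `a / b + (u / v)' = e / f`. A pole of `u / v` of order `j` at a normal
irreducible `P` becomes a pole of `(u / v)'` of order `j + 1`, which the pole of `a / b` of order at
most one cannot cancel. -/
theorem sq_dvd_of_dvd_denom {P : k[X]} (hP : Irreducible P) (hδ : ¬ P ∣ δ P)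
    (hb : Squarefree b) (huv : IsCoprime u v) (hv : v ≠ 0)
    (h : f * (a * v ^ 2 + b * (δ u * v - u * δ v)) = e * b * v ^ 2) (hPv : P ∣ v) :
    P ^ 2 ∣ f := by
  have hp := hP.prime
  obtain ⟨j, w, hw, rfl⟩ := (FiniteMultiplicity.of_prime_left hp hv).exists_eq_pow_mul_and_not_dvd
    |> fun ⟨w, h1, h2⟩ => (⟨_, w, h2, h1⟩ : ∃ j w, ¬ P ∣ w ∧ v = P ^ j * w)
  obtain ⟨j, rfl⟩ : ∃ l, j = l + 1 := by
    refine Nat.exists_eq_succ_of_ne_zero ?_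
    rintro rfl
    exact hw (by simpa using hPv)
  have hPu : ¬ P ∣ u := fun hu => hP.not_isUnit (huv.isUnit_of_dvd' hu hPv)
  set z := δ u * P * w - u * ((j + 1 : ℕ) * δ P * w + P * δ w) with hz
  have hPz : ¬ P ∣ z := by
    intro hd
    have h1 : P ∣ (j + 1 : ℕ) * (u * δ P * w) := by
      have : ((j + 1 : ℕ) : k[X]) * (u * δ P * w) = P * (δ u * w - u * δ w) - z := by
        rw [hz]; ring
      rw [this]
      exact dvd_sub (dvd_mul_right _ _) hd
    rcases hp.dvd_or_dvd h1 with h2 | h2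
    · refine hP.not_isUnit (isUnit_of_dvd_unit h2 ?_)
      rw [← map_natCast C]
      exact Polynomial.isUnit_C.2 (isUnit_iff_ne_zero.2 (by exact_mod_cast j.succ_ne_zero))
    · rcases hp.dvd_or_dvd h2 with h3 | h3
      · exact (hp.dvd_or_dvd h3).elim hPu hδ
      · exact hw h3
  have hzeq : δ u * (P ^ (j + 1) * w) - u * δ (P ^ (j + 1) * w) = P ^ j * z := by
    rw [Derivation.leibniz, Derivation.leibniz_pow, hz]
    simp only [smul_eq_mul, nsmul_eq_mul, Nat.add_sub_cancel]
    ring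
  rw [hzeq] at h
  have hPj : P ^ j ≠ 0 := pow_ne_zero _ hP.ne_zero
  have h' : f * (a * P ^ (j + 2) * w ^ 2 + b * z) = P ^ 2 * (P ^ j * (e * b * w ^ 2)) := by
    apply mul_left_cancel₀ hPj
    linear_combination h
  by_cases hPb : P ∣ b
  · obtain ⟨b', rfl⟩ := hPb
    have hb' : ¬ P ∣ b' := fun ⟨c, hc⟩ => hP.not_isUnit (hb P ⟨c, by rw [hc]; ring⟩)
    have h'' : f * (a * P ^ (j + 1) * w ^ 2 + b' * z) = P ^ 2 * (P ^ j * (e * b' * w ^ 2)) := by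
      apply mul_left_cancel₀ hP.ne_zero
      linear_combination h'
    refine hp.pow_dvd_of_dvd_mul_right 2 (fun hd => ?_) (Dvd.intro _ h''.symm)
    have : P ∣ b' * z := (dvd_add_right ⟨a * P ^ j * w ^ 2, by ring⟩).1 hd
    exact (hp.dvd_or_dvd this).elim hb' hPz
  · refine hp.pow_dvd_of_dvd_mul_right 2 (fun hd => ?_) (Dvd.intro _ h'.symm)
    have : P ∣ b * z := (dvd_add_right ⟨a * P ^ (j + 1) * w ^ 2, by ring⟩).1 hd
    exact (hp.dvd_or_dvd this).elim hPb hPz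

/-- A squarefree denominator of `a / b` survives in `a / b + (u / v)' = e / f`: its irreducible
factors that do not divide `v` are still poles, and those that do become poles of higher order. -/
theorem dvd_denom_of_hermite (hδ : ∀ P, Irreducible P → ¬ P ∣ δ P)
    (hb : Squarefree b) (hab : IsCoprime a b) (huv : IsCoprime u v) (hv : v ≠ 0) (hf : f ≠ 0)
    (h : f * (a * v ^ 2 + b * (δ u * v - u * δ v)) = e * b * v ^ 2) : b ∣ f := by
  refine hb.dvd_of_forall_irreducible hf fun P hP hPb => ?_
  by_cases hPv : P ∣ v
  · exact (dvd_pow_self P two_ne_zero).trans (sq_dvd_of_dvd_denom hP (hδ P hP) hb huv hv h hPv)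
  · have h1 : P ∣ f * (a * v ^ 2 + b * (δ u * v - u * δ v)) := by
      rw [h]; exact (hPb.mul_left e).mul_right _
    refine (hP.prime.dvd_or_dvd h1).resolve_right fun h2 => ?_
    have h3 : P ∣ a * v ^ 2 := (dvd_add_left (hPb.mul_right _)).1 h2
    rcases hP.prime.dvd_or_dvd h3 with h4 | h4
    · exact hP.not_isUnit (hab.isUnit_of_dvd' h4 hPb)
    · exact hPv (hP.prime.dvd_of_dvd_pow h4)

theorem isUnit_denom_of_hermite (hδ : ∀ P, Irreducible P → ¬ P ∣ δ P)
    (hb : Squarefree b) (huv : IsCoprime u v) (hv : v ≠ 0) (hf : Squarefree f)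
    (h : f * (a * v ^ 2 + b * (δ u * v - u * δ v)) = e * b * v ^ 2) : IsUnit v := by
  by_contra hu
  obtain ⟨P, hP, hPv⟩ := WfDvdMonoid.exists_irreducible_factor hu hv
  have h2 := sq_dvd_of_dvd_denom hP (hδ P hP) hb huv hv h hPv
  exact hP.not_isUnit (hf P (by rwa [← sq]))

end Hermite

namespace DiffTower

variable {C F : Type*} [Field C] [Field F] [Algebra C F] {n : ℕ} (T : DiffTower C F n)

/-! ### The derivation on polynomials in one generator -/

theorem D_mem_below (i : Fin (n + 1)) {f : F} (hf : f ∈ T.below i) : T.D f ∈ T.below i := by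
  refine IntermediateField.adjoin_induction C (p := fun f _ => T.D f ∈ T.below i)
    ?_ ?_ ?_ ?_ ?_ hf
  · rintro _ ⟨j, hj, rfl⟩
    exact T.K_le_below hj (T.deriv_mem j)
  · intro c
    rw [Derivation.map_algebraMap]
    exact zero_mem _
  · intro x y _ _ hx hy
    rw [map_add]
    exact add_mem hx hy
  · intro x hx hDx
    rw [Derivation.leibniz_inv, smul_eq_mul]
    exact mul_mem (neg_mem (pow_mem (inv_mem hx) 2)) hDx
  · intro x y hx hy hDx hDy
    rw [Derivation.leibniz, smul_eq_mul, smul_eq_mul]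
    exact add_mem (mul_mem hx hDy) (mul_mem hy hDx)

/-- The restriction of the derivation of the tower to `C(t_0, …, t_{i-1})`. -/
def belowD (i : Fin (n + 1)) : Derivation ℤ (T.below i) (T.below i) :=
  Derivation.mk' (AddMonoidHom.toIntLinearMap
    { toFun := fun x => ⟨T.D x, T.D_mem_below i x.2⟩
      map_zero' := Subtype.ext (map_zero T.D)
      map_add' := fun x y => Subtype.ext (map_add T.D (x : F) y) })
    fun x y => Subtype.ext (T.D.leibniz (x : F) y)

@[simp]
theorem coe_belowD (i : Fin (n + 1)) (x : T.below i) : (T.belowD i x : F) = T.D x := rfl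

/-- The derivation on polynomials in `t_i` over `C(t_0, …, t_{i-1})` that extends the derivation of
the coefficients and takes the value `a` on the variable. It is the derivation of the tower when
`a = t_i'`. -/
def polyD (i : Fin (n + 1)) (a : T.below i) : Derivation ℤ (T.below i)[X] (T.below i)[X] :=
  letI : Differential (T.below i) := ⟨T.belowD i⟩
  Differential.mapCoeffs + (Polynomial.C a • derivative'.restrictScalars ℤ : Derivation ℤ _ _)

theorem coeff_polyD (i : Fin (n + 1)) (a : T.below i) (p : (T.below i)[X]) (k : ℕ) :
    (T.polyD i a p).coeff k = T.belowD i (p.coeff k) + a * (p.coeff (k + 1) * (k + 1)) := by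
  let : Differential (T.below i) := ⟨T.belowD i⟩
  have : T.polyD i a p = Differential.mapCoeffs p + Polynomial.C a * derivative p := rfl
  rw [this, coeff_add, Differential.coeff_mapCoeffs, coeff_C_mul, coeff_derivative]
  rfl

theorem aeval_polyD (i : Fin (n + 1)) {a : T.below i} (ha : (a : F) = T.D (T.t i))
    (p : (T.below i)[X]) : aeval (T.t i) (T.polyD i a p) = T.D (aeval (T.t i) p) := by
  induction p using Polynomial.induction_on' with
  | add p q hp hq => simp only [map_add, hp, hq]
  | monomial k c =>
    let : Differential (T.below i) := ⟨T.belowD i⟩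
    have h1 : T.polyD i a (Polynomial.monomial k c) =
      Differential.mapCoeffs (Polynomial.monomial k c) +
        Polynomial.C a * derivative (Polynomial.monomial k c) := rfl
    have h2 : Differential.mapCoeffs (Polynomial.monomial k c) =
        Polynomial.monomial k (T.belowD i c) := Differential.mapCoeffs_monomial k c
    rw [h1, h2, derivative_monomial, map_add, map_mul, aeval_C, aeval_monomial, aeval_monomial,
      aeval_monomial, Derivation.leibniz, Derivation.leibniz_pow]
    simp only [IntermediateField.algebraMap_apply, coe_belowD, ha, smul_eq_mul, nsmul_eq_mul]
    push_cast
    ring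

theorem degree_polyD_le (i : Fin (n + 1)) (a : T.below i) (p : (T.below i)[X]) :
    (T.polyD i a p).degree ≤ p.degree := by
  rw [degree_le_iff_coeff_zero]
  intro k hk
  rw [coeff_polyD, coeff_eq_zero_of_degree_lt hk,
    coeff_eq_zero_of_degree_lt (hk.trans (by exact_mod_cast k.lt_succ_self))]
  simp

theorem aeval_injective (i : Fin (n + 1)) :
    Function.Injective (aeval (T.t i) : (T.below i)[X] →ₐ[T.below i] F) :=
  transcendental_iff_injective.1 (T.transcendental_below i)

theorem exists_algebraMap_eq_of_mem_below_zero {f : F} (hf : f ∈ T.below 0) :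
    ∃ c : C, algebraMap C F c = f := by
  have : T.below 0 = ⊥ := by
    unfold below
    convert IntermediateField.adjoin_empty C F using 2
    ext
    simp
  rw [this] at hf
  exact hf

theorem charZero_below [CharZero C] (i : Fin (n + 1)) : CharZero (T.below i) :=
  charZero_of_injective_algebraMap (algebraMap C _).injective

theorem eq_C_of_polyD_eq_zero [CharZero C] {a : T.below 0} (ha : (a : F) = T.D (T.t 0))
    {p : (T.below 0)[X]} (hp : T.polyD 0 a p = 0) : p = Polynomial.C (p.coeff 0) := by
  have := T.charZero_below 0
  have ha1 : a = 1 := Subtype.ext (ha.trans T.deriv_x)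
  have hD (x : T.below 0) : T.belowD 0 x = 0 := by
    obtain ⟨c, hc⟩ := T.exists_algebraMap_eq_of_mem_below_zero x.2
    refine Subtype.ext ?_
    rw [coe_belowD, ← hc]
    exact T.D.map_algebraMap c
  ext k
  rcases k with _ | k
  · simp
  · have h1 := T.coeff_polyD 0 a p k
    rw [hp, hD, ha1] at h1
    have h2 : (k : T.below 0) + 1 ≠ 0 := by exact_mod_cast k.succ_ne_zero
    simpa [h2, coeff_C] using h1

theorem aeval_mem_K (i : Fin (n + 1)) (p : (T.below i)[X]) : aeval (T.t i) p ∈ T.K i := by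
  rw [mem_K_iff]
  exact (IntermediateField.mem_adjoin_simple_iff _ _).2 ⟨p, 1, by simp⟩

/-- In a primitive tower every irreducible polynomial in `t_i` is normal: for a monic `P`, the
derivative has lower degree, so `P` divides it only if `P(t_i)` is a constant, which must then lie
in the smaller field. For `i = 0` the derivation is `d/dx`, and `P` is separable. -/
theorem not_dvd_polyD [CharZero C] (hT : T.IsPrimitive) (i : Fin (n + 1)) {a : T.below i}
    (ha : (a : F) = T.D (T.t i)) {P : (T.below i)[X]} (hP : Irreducible P) :
    ¬ P ∣ T.polyD i a P := by
  intro hd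
  set l := P.leadingCoeff with hl
  have hl0 : l ≠ 0 := leadingCoeff_ne_zero.2 hP.ne_zero
  set Q := P * Polynomial.C l⁻¹ with hQ
  have hQm : Q.Monic := monic_mul_leadingCoeff_inv hP.ne_zero
  have hPQ : P ∣ T.polyD i a Q := by
    rw [hQ, Derivation.leibniz, smul_eq_mul, smul_eq_mul]
    exact dvd_add (dvd_mul_right _ _) (hd.mul_left _)
  have hdeg : Q.degree = P.degree := degree_mul_leadingCoeff_inv _ hP.ne_zero
  have hlt : (T.polyD i a Q).degree < P.degree := by
    rw [← hdeg]
    refine lt_of_le_of_ne (T.degree_polyD_le i a Q) fun h => ?_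
    have h1 : (T.polyD i a Q).coeff Q.natDegree = 0 := by
      rw [coeff_polyD, coeff_natDegree, hQm.leadingCoeff, coeff_eq_zero_of_natDegree_lt
        Q.natDegree.lt_succ_self]
      simp
    rw [← natDegree_eq_of_degree_eq h, coeff_natDegree, leadingCoeff_eq_zero] at h1
    rw [h1, degree_zero, eq_comm, degree_eq_bot] at h
    exact hQm.ne_zero h
  have h0 : T.polyD i a Q = 0 := eq_zero_of_dvd_of_degree_lt hPQ hlt
  have hPpos := degree_pos_of_irreducible hP
  rw [← hdeg] at hPpos
  have key : ∃ c, Q = Polynomial.C c := by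
    by_cases hi : i = 0
    · subst hi
      exact ⟨_, T.eq_C_of_polyD_eq_zero ha h0⟩
    · have := (hT i hi).2 _ (T.aeval_mem_K i Q) (by rw [← T.aeval_polyD i ha, h0, map_zero])
      exact ⟨⟨_, this⟩, T.aeval_injective i (by simp)⟩
  obtain ⟨c, hc⟩ := key
  rw [hc] at hPpos
  exact absurd hPpos (not_lt.2 degree_C_le)

theorem exists_coe_eq_D_t (hT : T.IsPrimitive) (i : Fin (n + 1)) :
    ∃ a : T.below i, (a : F) = T.D (T.t i) := by
  by_cases hi : i = 0
  · exact ⟨1, by rw [hi, T.deriv_x]; rfl⟩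
  · exact ⟨⟨_, (hT i hi).1⟩, rfl⟩

theorem D_div_aeval (i : Fin (n + 1)) {a : T.below i} (ha : (a : F) = T.D (T.t i))
    (u : (T.below i)[X]) {v : (T.below i)[X]} (hv : v ≠ 0) :
    T.D (aeval (T.t i) u / aeval (T.t i) v) =
      aeval (T.t i) (T.polyD i a u * v - u * T.polyD i a v) / aeval (T.t i) (v ^ 2) := by
  have h0 := T.aeval_ne_zero i hv
  rw [Derivation.leibniz_div]
  simp only [map_sub, map_mul, map_pow, T.aeval_polyD i ha, smul_eq_mul]
  field_simp

theorem IsProper.D {T : DiffTower C F n} (hT : T.IsPrimitive) {i : Fin (n + 1)} {f : F}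
    (hf : T.IsProper i f) : T.IsProper i (T.D f) := by
  obtain ⟨a, ha⟩ := T.exists_coe_eq_D_t hT i
  rw [isProper_iff] at hf ⊢
  obtain ⟨p, q, hq, h, rfl⟩ := hf
  refine ⟨_, _, hq.pow 2, ?_, T.D_div_aeval i ha p hq.ne_zero⟩
  have hlt : p.degree + q.degree < (q ^ 2).degree := by
    rw [sq, degree_mul]
    exact WithBot.add_lt_add_right (by simpa [degree_eq_bot] using hq.ne_zero) h
  refine lt_of_le_of_lt (degree_sub_le _ _) (max_lt ?_ ?_)
  · rw [degree_mul]
    exact lt_of_le_of_lt (by gcongr; exact T.degree_polyD_le i a p) hlt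
  · rw [degree_mul]
    exact lt_of_le_of_lt (by gcongr; exact T.degree_polyD_le i a q) hlt

/-! ### Squarefree denominators -/

/-- `f` can be written as a fraction of polynomials in `t_i` with squarefree denominator. -/
def HasSquarefreeDenom (i : Fin (n + 1)) (f : F) : Prop :=
  ∃ p q : (T.below i)[X], Squarefree q ∧ f = aeval (T.t i) p / aeval (T.t i) q

variable {T}

theorem HasSquarefreeDenom.add {i : Fin (n + 1)} {f g : F} (hf : T.HasSquarefreeDenom i f)
    (hg : T.HasSquarefreeDenom i g) : T.HasSquarefreeDenom i (f + g) := by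
  classical
  obtain ⟨p, q, hq, rfl⟩ := hf
  obtain ⟨p', q', hq', rfl⟩ := hg
  have h0 : q * q' ≠ 0 := mul_ne_zero hq.ne_zero hq'.ne_zero
  obtain ⟨c, hc⟩ := (UniqueFactorizationMonoid.dvd_radical_iff hq.isRadical h0).2
    (dvd_mul_right q q')
  obtain ⟨c', hc'⟩ := (UniqueFactorizationMonoid.dvd_radical_iff hq'.isRadical h0).2
    (dvd_mul_left q' q)
  set L := UniqueFactorizationMonoid.radical (q * q') with hL
  have hLs : Squarefree L := UniqueFactorizationMonoid.squarefree_radical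
  have hc0 : c ≠ 0 := fun h => hLs.ne_zero (by rw [hc, h, mul_zero])
  have hc0' : c' ≠ 0 := fun h => hLs.ne_zero (by rw [hc', h, mul_zero])
  refine ⟨p * c + p' * c', L, hLs, ?_⟩
  rw [map_add, add_div]
  congr 1
  · rw [hc, map_mul, map_mul, mul_div_mul_right _ _ (T.aeval_ne_zero i hc0)]
  · rw [hc', map_mul, map_mul, mul_div_mul_right _ _ (T.aeval_ne_zero i hc0')]

theorem HasSquarefreeDenom.smul {i : Fin (n + 1)} {f : F} (c : C)
    (hf : T.HasSquarefreeDenom i f) : T.HasSquarefreeDenom i (c • f) := by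
  obtain ⟨p, q, hq, rfl⟩ := hf
  refine ⟨Polynomial.C (algebraMap C _ c) * p, q, hq, ?_⟩
  rw [map_mul, aeval_C, Algebra.smul_def, mul_div_assoc]
  rfl

theorem HasSquarefreeDenom.aeval (i : Fin (n + 1)) (p : (T.below i)[X]) :
    T.HasSquarefreeDenom i (aeval (T.t i) p) := ⟨p, 1, squarefree_one, by simp⟩

/-- A square factor `x ^ 2` of `p` would make `x` a common factor of `p` and its derivative. -/
theorem squarefree_of_isNormal (hT : T.IsPrimitive) {i : Fin (n + 1)} {p : (T.below i)[X]}
    (h : T.IsNormal i p) : Squarefree p := by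
  obtain ⟨a, ha⟩ := T.exists_coe_eq_D_t hT i
  obtain ⟨q, hq, hc⟩ := h
  rw [← T.aeval_polyD i ha] at hq
  obtain rfl := T.aeval_injective i hq
  rintro x ⟨y, rfl⟩
  refine hc.isUnit_of_dvd' ⟨x * y, by ring⟩ ?_
  simp only [Derivation.leibniz, smul_eq_mul]
  exact ⟨T.polyD i a y * x + y * T.polyD i a x + y * T.polyD i a x, by ring⟩

theorem IsSimpleAt.isProper {i : Fin (n + 1)} {f : F} (h : T.IsSimpleAt i f) : T.IsProper i f := by
  obtain ⟨g, h1, h2, -⟩ := h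
  exact ⟨g, h1, h2⟩

theorem IsSimpleAt.hasSquarefreeDenom (hT : T.IsPrimitive) {i : Fin (n + 1)} {f : F}
    (h : T.IsSimpleAt i f) : T.HasSquarefreeDenom i f := by
  obtain ⟨g, rfl, -, h2⟩ := h
  exact ⟨g.num, g.denom, squarefree_of_isNormal hT h2, rfl⟩

/-- A fraction whose denominator is a unit is a polynomial, so it is zero if it is proper. -/
theorem eq_zero_of_isUnit_denom {i : Fin (n + 1)} {q : F} (hq : T.IsProper i q)
    (u : (T.below i)[X]) {v : (T.below i)[X]} (hv : IsUnit v)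
    (h : q = Polynomial.aeval (T.t i) u / Polynomial.aeval (T.t i) v) : q = 0 := by
  obtain ⟨w, hw⟩ := hv.exists_left_inv
  refine (T.proper_add_poly i hq (p := -(u * w)) ?_).1
  rw [h, map_neg, map_mul, add_neg_eq_zero, div_eq_iff (T.aeval_ne_zero i hv.ne_zero), mul_assoc,
    ← map_mul, hw, map_one, mul_one]

/-- Hermite reduction: no nonzero proper fraction has a derivative with squarefree denominator. -/
theorem IsProper.eq_zero_of_D [CharZero C] (hT : T.IsPrimitive) {i : Fin (n + 1)} {q : F}
    (hq : T.IsProper i q) (h : T.HasSquarefreeDenom i (T.D q)) : q = 0 := by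
  have := T.charZero_below i
  obtain ⟨a, ha⟩ := T.exists_coe_eq_D_t hT i
  obtain ⟨g, hg, hlt⟩ := hq
  have hgq : q = Polynomial.aeval (T.t i) g.num / Polynomial.aeval (T.t i) g.denom := hg.symm
  obtain ⟨e, f, hf, he⟩ := h
  refine eq_zero_of_isUnit_denom ⟨g, hg, hlt⟩ g.num ?_ hgq
  refine isUnit_denom_of_hermite (δ := T.polyD i a) (a := 0) (b := 1) (e := e)
    (fun P hP => T.not_dvd_polyD hT i ha hP) squarefree_one g.isCoprime_num_denom g.denom_ne_zero
    hf ?_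
  rw [hgq, T.D_div_aeval i ha _ g.denom_ne_zero, div_eq_div_iff
    (T.aeval_ne_zero i (pow_ne_zero _ g.denom_ne_zero)) (T.aeval_ne_zero i hf.ne_zero),
    ← map_mul, ← map_mul] at he
  have := T.aeval_injective i he
  linear_combination this

/-- The constants of a primitive tower are those of `C`. -/
theorem mem_range_of_D_eq_zero [CharZero C] (hT : T.IsPrimitive) {f : F} (hf : T.D f = 0) :
    ∃ c : C, algebraMap C F c = f := by
  have key : ∀ i, f ∈ T.K i → ∃ c : C, algebraMap C F c = f := by
    intro i
    induction i using Fin.induction with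
    | zero =>
      intro hmem
      obtain ⟨a, ha⟩ := T.exists_coe_eq_D_t hT 0
      obtain ⟨q, hq, p, rfl⟩ := T.exists_proper_add_poly 0 hmem
      rw [map_add, ← T.aeval_polyD 0 ha] at hf
      obtain ⟨h1, h2⟩ := T.proper_add_poly 0 (hq.D hT) hf
      obtain rfl := hq.eq_zero_of_D hT
        (by rw [h1]; simpa using HasSquarefreeDenom.aeval (T := T) 0 0)
      obtain ⟨c, hc⟩ := T.exists_algebraMap_eq_of_mem_below_zero (p.coeff 0).2
      refine ⟨c, ?_⟩
      rw [T.eq_C_of_polyD_eq_zero ha h2]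
      simpa using hc
    | succ i ih =>
      intro hmem
      exact ih (by rw [← below_succ]; exact (hT i.succ i.succ_ne_zero).2 f hmem hf)
  exact key (Fin.last n) (by rw [K_last]; trivial)

/-- If the derivative of `p(t_i)` has degree at most `d`, then the coefficient of `p` of degree
`d + 1` is a constant. The point is that `p` has degree at most `d + 1`: if its degree were
`e > d + 1`, the coefficients of degrees `e` and `e - 1` of the derivative would make
`p_{e-1} + e p_e t_i` a constant outside `C(t_0, …, t_{i-1})`. -/
theorem D_coeff_succ_eq_zero [CharZero C] (hT : T.IsPrimitive) {i : Fin (n + 1)} (hi : i ≠ 0)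
    {a : T.below i} (ha : (a : F) = T.D (T.t i)) (p : (T.below i)[X]) (d : ℕ)
    (h : ∀ k, d < k → (T.polyD i a p).coeff k = 0) : T.D (p.coeff (d + 1)) = 0 := by
  have : CharZero F := charZero_of_injective_algebraMap (algebraMap C F).injective
  by_cases hdeg : p.natDegree ≤ d + 1
  · have := h (d + 1) (Nat.lt_succ_self d)
    rw [coeff_polyD, coeff_eq_zero_of_natDegree_lt (Nat.lt_succ_of_le hdeg)] at this
    simpa using congrArg (fun x : T.below i => (x : F)) this
  · exfalso
    obtain ⟨e, he⟩ : ∃ e, p.natDegree = e + 2 :=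
      ⟨p.natDegree - 2, by omega⟩
    have h1 := congrArg (fun x : T.below i => (x : F)) (h (e + 2) (by omega))
    have h2 := congrArg (fun x : T.below i => (x : F)) (h (e + 1) (by omega))
    simp only [coeff_polyD, coeff_eq_zero_of_natDegree_lt (show p.natDegree < e + 2 + 1 by omega)]
      at h1 h2
    push_cast at h1 h2
    simp only [coe_belowD, zero_mul, mul_zero, add_zero, ha] at h1 h2
    set l : F := ((p.coeff (e + 2) : T.below i) : F) with hl
    have hl0 : l ≠ 0 := by
      rw [hl, ← he, coeff_natDegree]
      simp only [ne_eq, ZeroMemClass.coe_eq_zero, leadingCoeff_eq_zero]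
      rintro rfl
      simp at he
    have hlmem : l ∈ T.below i := (p.coeff (e + 2)).2
    set b : F := ((e : F) + 2) * l with hb
    have hb0 : b ≠ 0 := mul_ne_zero (by exact_mod_cast (e + 1).succ_ne_zero) hl0
    have hbmem : b ∈ T.below i := mul_mem (add_mem (natCast_mem _ e) (ofNat_mem _ 2)) hlmem
    have hDb : T.D b = 0 := by
      have : b = (e + 2 : ℕ) • l := by rw [hb, nsmul_eq_mul]; push_cast; ring
      rw [this, map_nsmul, h1, smul_zero]
    have hconst : T.D (p.coeff (e + 1) + b * T.t i) = 0 := by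
      rw [map_add, Derivation.leibniz, hDb, smul_zero, add_zero, smul_eq_mul, hb, ← h2]
      ring
    have hmem := (hT i hi).2 _ (add_mem (T.below_le_K i (p.coeff (e + 1)).2)
      (mul_mem (T.below_le_K i hbmem) (T.t_mem_K i))) hconst
    have ht : T.t i ∈ T.below i := by
      have := div_mem (sub_mem hmem (p.coeff (e + 1)).2) hbmem
      rwa [add_sub_cancel_left, mul_div_cancel_left₀ _ hb0] at this
    exact T.transcendental_below i (isAlgebraic_algebraMap (⟨_, ht⟩ : T.below i))

/-! ### Coefficients of power products -/

theorem isExpansion_expansion (f : F) : T.IsExpansion f (T.expansion f) :=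
  (T.existsUnique_isExpansion f).choose_spec.1

theorem IsExpansion.expansion_eq {f : F} {c : Fin (n + 1) → Mon n →₀ F}
    (h : T.IsExpansion f c) : T.expansion f = c :=
  (T.existsUnique_isExpansion f).unique (T.isExpansion_expansion f) h

theorem IsBounded.expansion_eq {i : Fin (n + 1)} {f : F} {c : Fin (n + 1) → Mon n →₀ F}
    (h : T.IsBounded i c) (hs : ∑ j, T.combo (c j) = f) : T.expansion f = c :=
  IsExpansion.expansion_eq ⟨h.1, hs⟩

theorem isBounded_expansion {i : Fin (n + 1)} {f : F} (hf : f ∈ T.K i) :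
    T.IsBounded i (T.expansion f) := by
  obtain ⟨c, hc, hs⟩ := T.exists_isBounded i f hf
  rwa [hc.expansion_eq hs]

theorem isBounded_last_expansion (f : F) : T.IsBounded (Fin.last n) (T.expansion f) :=
  isBounded_expansion (by rw [K_last]; trivial)

variable (T) in
theorem expansion_add (f g : F) : T.expansion (f + g) = T.expansion f + T.expansion g :=
  ((isBounded_last_expansion f).add (isBounded_last_expansion g)).expansion_eq (by
    simp only [Pi.add_apply, combo_add, Finset.sum_add_distrib,
      (isExpansion_expansion f).2, (isExpansion_expansion g).2])

theorem expansion_sum_of_isCoef {a : Fin (n + 1) → F} (ha : ∀ j, T.IsCoef j (a j)) :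
    T.expansion (∑ j, a j) = fun i => Finsupp.single (toColex 0) (a i) := by
  refine IsExpansion.expansion_eq ⟨fun i => ?_, by simp only [combo_single_one]⟩
  have := (T.isBounded_single (ha i)).1 i
  rwa [Pi.single_eq_same] at this

theorem expansion_of_isCoef {i : Fin (n + 1)} {a : F} (ha : T.IsCoef i a) :
    T.expansion a = Pi.single i (Finsupp.single (toColex 0) a) :=
  (T.isBounded_single ha).expansion_eq (T.sum_combo_single i a)

variable (T) in
/-- The coefficient of the power product `M` in `f`, added up over all components of the
decomposition. If `M` is the head monomial of `f`, then it is the head coefficient. -/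
def coef (M : Mon n) : F →+ F where
  toFun f := ∑ i, T.expansion f i M
  map_zero' := by
    rw [expansion_of_isCoef (T.isCoef_zero 0)]
    simp
  map_add' f g := by simp [expansion_add, Finset.sum_add_distrib]

theorem coef_apply (M : Mon n) (f : F) : T.coef M f = ∑ i, T.expansion f i M := rfl

theorem sum_proj (f : F) : ∑ i, T.proj i f = f := (isExpansion_expansion f).2

theorem proj_add (i : Fin (n + 1)) (f g : F) : T.proj i (f + g) = T.proj i f + T.proj i g := by
  simp [proj, expansion_add, combo_add]

theorem proj_of_isCoef {i : Fin (n + 1)} {a : F} (ha : T.IsCoef i a) : T.proj i a = a := by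
  rw [proj, expansion_of_isCoef ha, Pi.single_eq_same, combo_single_one]

theorem IsProper.isCoef {i : Fin (n + 1)} {a : F} (ha : T.IsProper i a) : T.IsCoef i a := by
  unfold IsCoef
  split_ifs with h
  · subst h
    exact ha.mem
  · exact ha

theorem coef_of_isCoef {i : Fin (n + 1)} {a : F} (ha : T.IsCoef i a) (M : Mon n) :
    T.coef M a = if M = toColex 0 then a else 0 := by
  rw [coef_apply, expansion_of_isCoef ha, Finset.sum_eq_single i
    (fun j _ hj => by rw [Pi.single_eq_of_ne hj]; rfl) (by simp), Pi.single_eq_same,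
    Finsupp.single_apply]
  simp only [eq_comm]

theorem coef_eq_zero_of_mem {i : Fin (n + 1)} {f : F} (hf : f ∈ T.K i) {M : Mon n}
    {k : Fin (n + 1)} (hk : i < k) (hM : (ofColex M) k ≠ 0) : T.coef M f = 0 := by
  rw [coef_apply]
  refine Finset.sum_eq_zero fun j _ => ?_
  by_contra h
  exact hM (((isBounded_expansion hf).2 j M h).2 k hk)

/-- The elements of different `P_i` are independent, so adding up the components loses nothing. -/
theorem expansion_eq_zero_of_coef {f : F} {M : Mon n} (h : T.coef M f = 0) (i : Fin (n + 1)) :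
    T.expansion f i M = 0 := by
  have h1 := expansion_sum_of_isCoef (T := T) fun j => ((isExpansion_expansion f).1 j).2 M
  rw [← coef_apply, h, expansion_of_isCoef (T.isCoef_zero 0)] at h1
  simpa using (DFunLike.congr_fun (congrFun h1 i) (toColex 0)).symm

theorem eq_zero_of_expansion {f : F} (h : ∀ i M, T.expansion f i M = 0) : f = 0 := by
  rw [← sum_proj (T := T) f]
  refine Finset.sum_eq_zero fun i _ => ?_
  rw [proj, show T.expansion f i = 0 from Finsupp.ext (h i), combo_zero]

theorem eq_zero_of_coef {f : F} (h : ∀ M, T.coef M f = 0) : f = 0 :=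
  eq_zero_of_expansion (T := T) fun i M => expansion_eq_zero_of_coef (h M) i

theorem eq_coef_zero {f : F} (h : ∀ M, M ≠ toColex 0 → T.coef M f = 0) :
    f = T.coef (toColex 0) f := by
  conv_lhs => rw [← sum_proj (T := T) f]
  rw [coef_apply]
  refine Finset.sum_congr rfl fun i _ => T.combo_of_forall_eq fun M hM => ?_
  by_contra hne
  exact hM (expansion_eq_zero_of_coef (h M hne) i)

/-- Multiplication of power products by `t_i ^ k`. -/
def shift (i : Fin (n + 1)) (k : ℕ) (M : Mon n) : Mon n :=
  toColex (ofColex M + Finsupp.single i k)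

theorem shift_injective (i : Fin (n + 1)) (k : ℕ) : Function.Injective (shift i k) := fun _ _ h =>
  congrArg toColex (add_right_cancel (congrArg ofColex h))

theorem shift_erase (i : Fin (n + 1)) (M : Mon n) :
    shift i ((ofColex M) i) (toColex ((ofColex M).erase i)) = M :=
  congrArg toColex (Finsupp.erase_add_single i (ofColex M))

theorem shift_apply_self (i : Fin (n + 1)) (k : ℕ) (M : Mon n) :
    (ofColex (shift i k M)) i = (ofColex M) i + k := by simp [shift]

theorem shift_apply_of_ne {i j : Fin (n + 1)} (h : j ≠ i) (k : ℕ) (M : Mon n) :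
    (ofColex (shift i k M)) j = (ofColex M) j := by simp [shift, h]

theorem monomial_shift (i : Fin (n + 1)) (k : ℕ) (M : Mon n) :
    T.monomial (shift i k M) = T.monomial M * T.t i ^ k := by
  simp only [monomial, shift, ofColex_toColex, Finsupp.add_apply, pow_add, Finset.prod_mul_distrib]
  congr 1
  rw [Finset.prod_eq_single i]
  · simp
  · intro l _ hl
    simp [hl]
  · simp

theorem expansion_mul_pow {i : Fin n} {u : F} (hu : u ∈ T.below i.succ) (k : ℕ) :
    T.expansion (u * T.t i.succ ^ k) =
      fun j => Finsupp.mapDomain (shift i.succ k) (T.expansion u j) := by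
  rw [below_succ] at hu
  have hb := isBounded_expansion hu
  refine IsExpansion.expansion_eq ⟨fun j => ⟨?_, T.isCoef_mapDomain (hb.1 j).2 _⟩, ?_⟩
  · intro M h l hl
    obtain ⟨N, hN, rfl⟩ := exists_of_mapDomain h
    have hne : l ≠ i.succ :=
      ((hl.trans (hb.2 j N hN).1).trans_lt i.castSucc_lt_succ).ne
    rw [shift_apply_of_ne hne, (hb.1 j).1 N hN l hl]
  · conv_rhs => rw [← (isExpansion_expansion (T := T) u).2, Finset.sum_mul]
    refine Finset.sum_congr rfl fun j _ => ?_
    rw [combo, Finsupp.sum_mapDomain_index (by simp) (by intros; ring), combo, Finsupp.sum_mul]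
    refine Finsupp.sum_congr fun M _ => ?_
    rw [monomial_shift, mul_assoc]

theorem expansion_aeval_succ (i : Fin n) (p : (T.below i.succ)[X]) {j : Fin (n + 1)}
    (hj : i.succ ≤ j) : T.expansion (aeval (T.t i.succ) p) j = 0 := by
  induction p using Polynomial.induction_on' with
  | add p q hp hq => rw [map_add, expansion_add, Pi.add_apply, hp, hq, add_zero]
  | monomial k c =>
    rw [aeval_monomial, IntermediateField.algebraMap_apply, expansion_mul_pow c.2]
    have : T.expansion (c : F) j = 0 := by
      ext M
      by_contra h
      have hc : (c : F) ∈ T.K i.castSucc := by rw [← below_succ]; exact c.2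
      exact absurd ((isBounded_expansion hc).2 j M h).1
        (not_le.2 (i.castSucc_lt_succ.trans_le hj))
    exact (congrArg _ this).trans Finsupp.mapDomain_zero

theorem coef_aeval (i : Fin n) (p : (T.below i.succ)[X]) (M : Mon n) :
    T.coef M (aeval (T.t i.succ) p) =
      T.coef (toColex ((ofColex M).erase i.succ)) (p.coeff ((ofColex M) i.succ) : F) := by
  induction p using Polynomial.induction_on' with
  | add p q hp hq => simp only [map_add, hp, hq, coeff_add, IntermediateField.coe_add]
  | monomial k c =>
    rw [aeval_monomial, IntermediateField.algebraMap_apply, coeff_monomial, coef_apply,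
      expansion_mul_pow c.2]
    split_ifs with hk
    · subst hk
      rw [coef_apply]
      refine Finset.sum_congr rfl fun j _ => ?_
      conv_lhs => rw [← shift_erase i.succ M, shift_apply_self]
      simp only [ofColex_toColex, Finsupp.erase_same, zero_add]
      exact Finsupp.mapDomain_apply (shift_injective _ _) _ _
    · rw [ZeroMemClass.coe_zero, map_zero]
      refine Finset.sum_eq_zero fun j _ => ?_
      by_contra h
      obtain ⟨N, hN, rfl⟩ := exists_of_mapDomain h
      have hc : (c : F) ∈ T.K i.castSucc := by rw [← below_succ]; exact c.2
      have := ((isBounded_expansion hc).2 j N hN).2 _ i.castSucc_lt_succ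
      exact hk (by rw [shift_apply_self, this, zero_add])

/-! ### Sums of proper fractions with squarefree denominators -/

variable (T) in
/-- Every projection `π_i(f)` is a `t_i`-proper fraction with squarefree denominator. In a
primitive tower this is a consequence of simplicity, and it is visibly stable under `C`-linear
combinations. -/
def IsSquarefree (f : F) : Prop :=
  ∀ i, T.IsProper i (T.proj i f) ∧ T.HasSquarefreeDenom i (T.proj i f)

theorem IsSimple.isSquarefree (hT : T.IsPrimitive) {f : F} (hf : T.IsSimple f) :
    T.IsSquarefree f := fun i => ⟨(hf i).isProper, (hf i).hasSquarefreeDenom hT⟩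

theorem IsSquarefree.add {f g : F} (hf : T.IsSquarefree f) (hg : T.IsSquarefree g) :
    T.IsSquarefree (f + g) := fun i => by
  rw [proj_add]
  exact ⟨(hf i).1.add (hg i).1, (hf i).2.add (hg i).2⟩

theorem IsProper.smul {i : Fin (n + 1)} {f : F} (c : C) (hf : T.IsProper i f) :
    T.IsProper i (c • f) := by
  rw [isProper_iff] at *
  obtain ⟨p, q, hq, h, rfl⟩ := hf
  refine ⟨Polynomial.C (algebraMap C _ c) * p, q, hq, lt_of_le_of_lt ?_ h, ?_⟩
  · rw [← smul_eq_C_mul]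
    exact degree_smul_le _ _
  · rw [map_mul, aeval_C, Algebra.smul_def, mul_div_assoc]
    rfl

theorem isSquarefree_zero : T.IsSquarefree 0 := fun i => by
  have h := T.isProper_zero i
  rw [proj_of_isCoef h.isCoef]
  exact ⟨h, by simpa using HasSquarefreeDenom.aeval (T := T) i 0⟩

theorem IsSquarefree.smul {f : F} (c : C) (hf : T.IsSquarefree f) : T.IsSquarefree (c • f) := by
  intro i
  have h : T.proj i (c • f) = c • T.proj i f := by
    conv_lhs => rw [← sum_proj (T := T) f, Finset.smul_sum]
    rw [proj, expansion_sum_of_isCoef fun j => ((hf j).1.smul c).isCoef, combo_single_one]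
  rw [h]
  exact ⟨(hf i).1.smul c, (hf i).2.smul c⟩

theorem IsSquarefree.coef_eq {f : F} (hf : T.IsSquarefree f) (M : Mon n) :
    T.coef M f = if M = toColex 0 then f else 0 := by
  conv_lhs => rw [← sum_proj (T := T) f]
  rw [map_sum, Finset.sum_congr rfl fun i _ => coef_of_isCoef (hf i).1.isCoef M]
  split_ifs
  · exact sum_proj f
  · simp

theorem IsSquarefree.coef {f : F} (hf : T.IsSquarefree f) (M : Mon n) :
    T.IsSquarefree (T.coef M f) := by
  rw [hf.coef_eq]
  split_ifs
  · exact hf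
  · exact isSquarefree_zero

/-! ### Head coefficients of derivatives -/

theorem D_mem_K (hT : T.IsPrimitive) {i : Fin (n + 1)} {f : F} (hf : f ∈ T.K i) :
    T.D f ∈ T.K i := by
  obtain ⟨a, ha⟩ := T.exists_coe_eq_D_t hT i
  obtain ⟨q, hq, p, rfl⟩ := T.exists_proper_add_poly i hf
  rw [map_add, ← T.aeval_polyD i ha]
  exact add_mem (hq.D hT).mem (T.aeval_mem_K i _)

theorem ne_zero_of_gt {M N : Mon n} (h : M < N) : N ≠ toColex 0 :=
  ((bot_le (a := M)).trans_lt h).ne'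

theorem shift_lt_shift (i : Fin (n + 1)) (k : ℕ) {M N : Mon n} (h : M < N) :
    shift i k M < shift i k N := by
  obtain ⟨j, hj, hlt⟩ := Finsupp.Colex.lt_iff.1 h
  refine Finsupp.Colex.lt_iff.2 ⟨j, fun l hl => ?_, ?_⟩
  · simp [shift, hj l hl]
  · simpa [shift] using hlt

theorem lt_shift {i : Fin (n + 1)} {M N : Mon n} {k : ℕ} (hk : (ofColex M) i < k)
    (hM : ∀ l, i < l → (ofColex M) l = 0) (hN : ∀ l, i ≤ l → (ofColex N) l = 0) :
    M < shift i k N := by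
  refine Finsupp.Colex.lt_iff.2 ⟨i, fun l hl => ?_, ?_⟩
  · rw [shift_apply_of_ne hl.ne', hM l hl, hN l hl.le]
  · rwa [shift_apply_self, hN i le_rfl, zero_add]

theorem erase_shift {i : Fin (n + 1)} {N : Mon n} (k : ℕ) (hN : (ofColex N) i = 0) :
    toColex ((ofColex (shift i k N)).erase i) = N := by
  refine congrArg toColex (?_ : _ = ofColex N)
  ext j
  by_cases hj : j = i
  · subst hj
    simp [hN]
  · simp [shift, hj]

/-- An element of `K_0` whose derivative is squarefree is a constant. -/
theorem D_eq_zero_of_mem_K_zero [CharZero C] (hT : T.IsPrimitive) {h : F} (hh : h ∈ T.K 0)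
    (hs : T.IsSquarefree (T.D h)) : T.D h = 0 := by
  obtain ⟨a, ha⟩ := T.exists_coe_eq_D_t hT 0
  have hD : T.proj 0 (T.D h) = T.D h :=
    proj_of_isCoef (by rw [IsCoef, if_pos rfl]; exact D_mem_K hT hh)
  have hs0 := hs 0
  rw [hD] at hs0
  obtain ⟨q, hq, p, rfl⟩ := T.exists_proper_add_poly 0 hh
  rw [map_add, ← T.aeval_polyD 0 ha] at hs0 ⊢
  have hp : T.polyD 0 a p = 0 := by
    refine neg_eq_zero.1
      (T.proper_add_poly 0 (hs0.1.add (hq.D hT).neg) (p := -T.polyD 0 a p) ?_).2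
    rw [map_neg]
    ring
  rw [hp, map_zero, add_zero] at hs0 ⊢
  rw [hq.eq_zero_of_D hT hs0.2, map_zero]

/-- If `h` is in `K_i`, all coefficients of `h'` at power products above `M` vanish, and the one at
`M` is simple, then the latter is a `C`-linear combination of those `t_j'` with `0 < j ≤ i` for
which no `t_l` with `l < j` divides `M`. Write `h = q + ∑ p_k t_i ^ k`, where `q` is `t_i`-proper,
and let `d` be the exponent of `t_i` in `M`. The coefficient is the one of
`p_d' + (d + 1) p_{d+1} t_i'` at `M / t_i ^ d`, and `p_{d+1}` lies in `C`, so the claim follows from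
the one for `p_d`. -/
theorem coef_D_mem_span [CharZero C] (hT : T.IsSPrimitive) (i : Fin (n + 1)) : ∀ h ∈ T.K i,
    ∀ M : Mon n, (∀ N, M < N → T.coef N (T.D h) = 0) → T.IsSquarefree (T.coef M (T.D h)) →
      T.coef M (T.D h) ∈ Submodule.span C ((fun j => T.D (T.t j)) ''
        {j | 0 < j ∧ j ≤ i ∧ ∀ l, (ofColex M) l ≠ 0 → j ≤ l}) := by
  induction i using Fin.induction with
  | zero =>
    intro h hh M _ hs
    rw [coef_of_isCoef (i := 0) (by rw [IsCoef, if_pos rfl]; exact D_mem_K hT.1 hh)] at hs ⊢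
    split_ifs at hs ⊢
    · rw [D_eq_zero_of_mem_K_zero hT.1 hh hs]
      exact zero_mem _
    · exact zero_mem _
  | succ i ih =>
    intro h hh M hM hs
    by_cases hMl : ∃ l, i.succ < l ∧ (ofColex M) l ≠ 0
    · obtain ⟨l, hl, hMl⟩ := hMl
      rw [coef_eq_zero_of_mem (D_mem_K hT.1 hh) hl hMl]
      exact zero_mem _
    push Not at hMl
    obtain ⟨a, ha⟩ := T.exists_coe_eq_D_t hT.1 i.succ
    obtain ⟨q, hq, p, rfl⟩ := T.exists_proper_add_poly i.succ hh
    have hD : T.D (q + aeval (T.t i.succ) p) =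
        T.D q + aeval (T.t i.succ) (T.polyD i.succ a p) := by
      rw [map_add, T.aeval_polyD i.succ ha]
    rw [hD] at hM hs ⊢
    set g := T.polyD i.succ a p with hg
    -- If `M = 1`, then `h'` itself is simple, and Hermite reduction applies to `q`.
    have hq0 : M = toColex 0 → q = 0 := by
      rintro rfl
      have h1 := eq_coef_zero (T := T) (f := T.D q + aeval (T.t i.succ) g)
        fun N hN => hM N (lt_of_le_of_ne bot_le (Ne.symm hN))
      rw [← h1] at hs
      have h2 := (hs i.succ).2
      rw [proj_add, proj_of_isCoef (hq.D hT.1).isCoef, proj, expansion_aeval_succ i g le_rfl,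
        combo_zero, add_zero] at h2
      exact hq.eq_zero_of_D hT.1 h2
    have hcoef (N : Mon n) (hN : M ≤ N) : T.coef N (T.D q + aeval (T.t i.succ) g) =
        T.coef (toColex ((ofColex N).erase i.succ)) (g.coeff ((ofColex N) i.succ) : F) := by
      rw [map_add, coef_aeval, coef_of_isCoef (hq.D hT.1).isCoef, add_eq_right]
      split_ifs with h0
      · rw [hq0 (le_bot_iff.1 (hN.trans_eq h0)), map_zero]
      · rfl
    have hmem (k : ℕ) : (g.coeff k : F) ∈ T.K i.castSucc := by
      rw [← below_succ]; exact (g.coeff k).2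
    set d := (ofColex M) i.succ with hd
    set M' : Mon n := toColex ((ofColex M).erase i.succ) with hM'
    -- Multiplying any power product of lower generators by `t_i ^ k` with `k > d` leads above `M`.
    have hzero (k : ℕ) (hk : d < k) : g.coeff k = 0 := by
      refine Subtype.ext (eq_zero_of_coef (T := T) fun N => ?_)
      by_cases hN : ∃ l, i.castSucc < l ∧ (ofColex N) l ≠ 0
      · obtain ⟨l, hl, hNl⟩ := hN
        exact coef_eq_zero_of_mem (hmem k) hl hNl
      · push Not at hN
        have hlt : M < shift i.succ k N :=
          lt_shift hk hMl fun l hl => hN l (i.castSucc_lt_succ.trans_le hl)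
        have h1 := hcoef _ hlt.le
        have h0 := hN _ i.castSucc_lt_succ
        rw [hM _ hlt, erase_shift k h0, shift_apply_self, h0, zero_add] at h1
        exact h1.symm
    obtain ⟨c, hc⟩ := mem_range_of_D_eq_zero hT.1
      (T.D_coeff_succ_eq_zero hT.1 i.succ_ne_zero ha p d hzero)
    set σ : F := ((d + 1 : ℕ) * c : C) • T.D (T.t i.succ) with hσ
    have hσs : T.IsSquarefree σ := ((hT.2 i.succ i.succ_ne_zero).isSquarefree hT.1).smul _
    have hgd : (g.coeff d : F) = T.D (p.coeff d) + σ := by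
      rw [hg, coeff_polyD, hσ, Algebra.smul_def, map_mul, hc]
      push_cast
      rw [coe_belowD, ha]
      ring
    have hpd (N : Mon n) :
        T.coef N (T.D (p.coeff d)) = T.coef N (g.coeff d : F) - T.coef N σ := by
      rw [hgd, map_add, add_sub_cancel_right]
    have hhead : T.coef M (T.D q + aeval (T.t i.succ) g) = T.coef M' (g.coeff d : F) :=
      hcoef M le_rfl
    rw [hhead] at hs ⊢
    have hih := ih (p.coeff d) (by rw [← below_succ]; exact (p.coeff d).2) M' (fun N hN => by
      rw [hpd, hσs.coef_eq, if_neg (ne_zero_of_gt hN), sub_zero]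
      by_cases hNl : ∃ l, i.castSucc < l ∧ (ofColex N) l ≠ 0
      · obtain ⟨l, hl, hNl⟩ := hNl
        exact coef_eq_zero_of_mem (hmem d) hl hNl
      · push Not at hNl
        have h0 := hNl _ i.castSucc_lt_succ
        have hlt : M < shift i.succ d N := by
          have := shift_lt_shift i.succ d hN
          rwa [hM', hd, shift_erase] at this
        have h1 := hcoef _ hlt.le
        rw [hM _ hlt, erase_shift d h0, shift_apply_self, h0, zero_add] at h1
        exact h1.symm) (by
      rw [hpd, sub_eq_add_neg, ← neg_one_smul C (T.coef M' σ)]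
      exact hs.add ((hσs.coef M').smul _))
    rw [hgd, map_add]
    refine add_mem (Submodule.span_mono (Set.image_mono ?_) hih) ?_
    · rintro j ⟨hj0, hji, hjl⟩
      refine ⟨hj0, hji.trans i.castSucc_lt_succ.le, fun l hl => ?_⟩
      by_cases hli : l = i.succ
      · exact hli ▸ hji.trans i.castSucc_lt_succ.le
      · exact hjl l (by simpa [hM', Finsupp.erase_ne hli] using hl)
    · rw [hσs.coef_eq]
      split_ifs with h1
      · refine Submodule.smul_mem _ _ (Submodule.subset_span
          ⟨i.succ, ⟨i.succ_pos, le_rfl, fun l hl => ?_⟩, rfl⟩)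
        by_contra hli
        refine hl ?_
        have h2 := DFunLike.congr_fun (congrArg ofColex h1) l
        rwa [hM', ofColex_toColex, Finsupp.erase_ne (by rintro rfl; exact hli le_rfl)] at h2
      · exact zero_mem _

/-! ### Head monomials and denominators -/

theorem le_hm {f : F} {i : Fin (n + 1)} {M : Mon n} (h : T.expansion f i M ≠ 0) :
    (M : WithBot (Mon n)) ≤ T.hm f :=
  (Finset.le_max (Finsupp.mem_support_iff.2 h)).trans
    (Finset.le_sup (f := fun i => T.hmAt i f) (Finset.mem_univ i))

theorem expansion_eq_zero_of_hm_lt {f : F} {M : Mon n} (h : T.hm f < M) (i : Fin (n + 1)) :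
    T.expansion f i M = 0 := by
  by_contra hne
  exact absurd (le_hm hne) (not_le.2 h)

theorem coef_eq_zero_of_hm_lt {f : F} {M : Mon n} (h : T.hm f < M) : T.coef M f = 0 :=
  (coef_apply M f).trans (Finset.sum_eq_zero fun i _ => expansion_eq_zero_of_hm_lt h i)

theorem exists_expansion_ne_zero {f : F} {M : Mon n} (h : T.hm f = M) :
    ∃ i, T.expansion f i M ≠ 0 := by
  obtain ⟨i, -, hi⟩ := Finset.exists_mem_eq_sup Finset.univ Finset.univ_nonempty
    fun i => T.hmAt i f
  exact ⟨i, Finsupp.mem_support_iff.1 (Finset.mem_of_max (hi.symm.trans h))⟩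

theorem hm_zero : T.hm 0 = ⊥ := by
  rw [eq_bot_iff]
  refine Finset.sup_le fun i _ => ?_
  rw [hmAt, show T.expansion 0 i = 0 from Finsupp.ext fun M =>
    expansion_eq_zero_of_coef (map_zero _) i]
  simp

theorem eq_zero_of_hm_eq_bot {f : F} (h : T.hm f = ⊥) : f = 0 :=
  eq_zero_of_expansion fun _ M => expansion_eq_zero_of_hm_lt (h ▸ WithBot.bot_lt_coe M) _

theorem hc_eq_coef {f : F} {M : Mon n} (h : T.hm f = M) : T.hc f = T.coef M f := by
  rw [hc, coef_apply, Finset.sum_filter]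
  refine Finset.sum_congr rfl fun i _ => ?_
  split_ifs with hi
  · rw [h] at hi
    simp only [hcAt, hi]
  · by_contra hne
    refine hi (le_antisymm (Finset.le_sup (f := fun i => T.hmAt i f) (Finset.mem_univ i)) ?_)
    rw [h]
    exact Finset.le_max (Finsupp.mem_support_iff.2 (Ne.symm hne))

theorem coef_ne_zero_of_hm {f : F} {M : Mon n} (h : T.hm f = M) : T.coef M f ≠ 0 := by
  obtain ⟨i, hi⟩ := exists_expansion_ne_zero h
  exact fun h0 => hi (expansion_eq_zero_of_coef h0 i)

theorem le_ind {M : Mon n} {j : Fin (n + 1)} (h : ∀ l, (ofColex M) l ≠ 0 → j ≤ l) :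
    j ≤ ind (M : WithBot (Mon n)) := by
  simp only [ind]
  split_ifs with hne
  · exact h _ (Finsupp.mem_support_iff.1 (Finset.min'_mem _ hne))
  · exact Fin.le_last j

theorem exists_denomDegree_eq (f : F) : ∃ g : RatFunc (T.below (Fin.last n)),
    T.evalAt (Fin.last n) g = f ∧ T.denomDegree f = g.denom.natDegree :=
  ⟨_, (T.existsUnique_evalAt_last f).choose_spec.1, rfl⟩

theorem denomDegree_le (p : (T.below (Fin.last n))[X]) {q : (T.below (Fin.last n))[X]}
    (hq : q ≠ 0) : T.denomDegree (aeval (T.t (Fin.last n)) p / aeval (T.t (Fin.last n)) q) ≤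
      q.natDegree := by
  obtain ⟨g, hg, h⟩ := T.exists_denomDegree_eq
    (aeval (T.t (Fin.last n)) p / aeval (T.t (Fin.last n)) q)
  rw [h, (T.existsUnique_evalAt_last _).unique hg (T.evalAt_mk _ p q hq)]
  exact natDegree_le_of_dvd (RatFunc.denom_div_dvd p q) hq

theorem denomDegree_zero : T.denomDegree 0 = 0 := by
  have := T.denomDegree_le 0 one_ne_zero
  simpa using this

/-- Adding a derivative to an element whose projection `s` to `P_n` is simple does not lower the
degree of the denominator, and raises it unless the derivative is the one of a polynomial. -/
theorem denomDegree_add_D [CharZero C] (hT : T.IsPrimitive) {s q : F}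
    (hs : T.IsSimpleAt (Fin.last n) s) (hq : T.IsProper (Fin.last n) q)
    (w p : (T.below (Fin.last n))[X]) :
    T.denomDegree (s + aeval (T.t (Fin.last n)) w) ≤
        T.denomDegree (s + aeval (T.t (Fin.last n)) w + T.D (q + aeval (T.t (Fin.last n)) p)) ∧
      (T.denomDegree (s + aeval (T.t (Fin.last n)) w + T.D (q + aeval (T.t (Fin.last n)) p)) =
        T.denomDegree (s + aeval (T.t (Fin.last n)) w) → q = 0) := by
  have := T.charZero_below (Fin.last n)
  obtain ⟨a, ha⟩ := T.exists_coe_eq_D_t hT (Fin.last n)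
  obtain ⟨gs, rfl, -, hn⟩ := hs
  have hb := squarefree_of_isNormal hT hn
  have hδ (P : (T.below (Fin.last n))[X]) (hP : Irreducible P) := T.not_dvd_polyD hT _ ha hP
  have hle : T.denomDegree (T.evalAt (Fin.last n) gs + aeval (T.t (Fin.last n)) w) ≤
      gs.denom.natDegree := by
    have h1 := T.denomDegree_le (gs.num + w * gs.denom) gs.denom_ne_zero
    rwa [map_add, map_mul, add_div,
      mul_div_cancel_right₀ _ (T.aeval_ne_zero _ gs.denom_ne_zero)] at h1
  obtain ⟨g, hg, hdeg⟩ := T.exists_denomDegree_eq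
    (T.evalAt (Fin.last n) gs + aeval (T.t (Fin.last n)) w + T.D (q + aeval (T.t (Fin.last n)) p))
  rw [hdeg]
  obtain ⟨gq, hgq, hlt⟩ := hq
  have hqeq : q = aeval (T.t (Fin.last n)) gq.num / aeval (T.t (Fin.last n)) gq.denom := hgq.symm
  have hmain : g.denom * (gs.num * gq.denom ^ 2 + gs.denom *
      (T.polyD (Fin.last n) a gq.num * gq.denom - gq.num * T.polyD (Fin.last n) a gq.denom)) =
      (g.num - (w + T.polyD (Fin.last n) a p) * g.denom) * gs.denom * gq.denom ^ 2 := by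
    apply T.aeval_injective (Fin.last n)
    have h1 := T.aeval_ne_zero (Fin.last n) g.denom_ne_zero
    have h2 := T.aeval_ne_zero (Fin.last n) gs.denom_ne_zero
    have h3 := T.aeval_ne_zero (Fin.last n) gq.denom_ne_zero
    rw [map_add, hqeq, T.D_div_aeval _ ha _ gq.denom_ne_zero, ← T.aeval_polyD _ ha, evalAt_eq,
      evalAt_eq, map_pow, div_eq_iff h1] at hg
    simp only [map_mul, map_add, map_sub, map_pow] at hg ⊢
    rw [hg]
    field_simp
    ring
  have hdvd := dvd_denom_of_hermite hδ hb gs.isCoprime_num_denom gq.isCoprime_num_denom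
    gq.denom_ne_zero g.denom_ne_zero hmain
  refine ⟨hle.trans (natDegree_le_of_dvd hdvd g.denom_ne_zero), fun h => ?_⟩
  have hassoc : Associated gs.denom g.denom :=
    associated_of_dvd_of_natDegree_le hdvd g.denom_ne_zero (h.trans_le hle)
  exact eq_zero_of_isUnit_denom ⟨gq, hgq, hlt⟩ gq.num
    (isUnit_denom_of_hermite hδ hb gq.isCoprime_num_denom gq.denom_ne_zero
      (hassoc.squarefree_iff.1 hb) hmain) hqeq

/-- For `n ≥ 1` the sum `P_0 + ⋯ + P_{n-1}` consists of the polynomials in `t_n`; for `n = 0` it is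
zero. -/
theorem exists_aeval_eq_sub_proj_last (f : F) :
    ∃ w : (T.below (Fin.last n))[X], f - T.proj (Fin.last n) f = aeval (T.t (Fin.last n)) w ∧
      T.expansion (aeval (T.t (Fin.last n)) w) (Fin.last n) = 0 := by
  have htop (f : F) : f ∈ T.K (Fin.last n) := by rw [K_last]; trivial
  by_cases hn : Fin.last n = 0
  · refine ⟨0, ?_, ?_⟩
    · rw [proj_of_isCoef (by rw [IsCoef, if_pos hn, ← hn]; exact htop f), sub_self, map_zero]
    · rw [map_zero]
      exact Finsupp.ext fun M => expansion_eq_zero_of_coef (map_zero _) _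
  · obtain ⟨i, hi⟩ := Fin.exists_succ_eq.2 hn
    obtain ⟨q, hq, w, rfl⟩ := T.exists_proper_add_poly _ (htop f)
    have h0 : T.expansion (aeval (T.t (Fin.last n)) w) (Fin.last n) = 0 := by
      revert w
      rw [← hi]
      exact fun w => expansion_aeval_succ i w le_rfl
    refine ⟨w, ?_, h0⟩
    rw [proj_add, proj_of_isCoef hq.isCoef, proj, h0, combo_zero]
    ring

end DiffTower

end

theorem proposition4p8 {C F : Type*} [Field C] [CharZero C] [Field F] [Algebra C F] {n : ℕ}
    (T : DiffTower C F n) (hT : T.IsSPrimitive) (r : F) (m : Fin (n + 1))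
    (hm : m = DiffTower.ind (T.hm r))
    (hr : r = 0 ∨
      (T.IsSimpleAt (Fin.last n) (T.proj (Fin.last n) r) ∧
        T.IsSimple (T.hc (r - T.proj (Fin.last n) r)) ∧
        ¬ (T.hc (r - T.proj (Fin.last n) r) ≠ 0 ∧
          T.hc (r - T.proj (Fin.last n) r) ∈
            Submodule.span C ((fun j => T.D (T.t j)) '' Set.Ioc 0 m)))) :
    T.IsRemainder r := by
  open DiffTower Polynomial in
  refine ⟨⟨0, by simp⟩, ?_⟩
  rintro G ⟨h, hG⟩ hlow
  rcases hr with rfl | ⟨hs, hsimple, hspan⟩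
  · rcases hlow with h1 | ⟨-, h1⟩
    · simp [denomDegree_zero] at h1
    · simp [hm_zero] at h1
  obtain ⟨w, hw, hw0⟩ := exists_aeval_eq_sub_proj_last (T := T) r
  rw [hw] at hsimple hspan
  set s := T.proj (Fin.last n) r with hsdef
  have hrw : r = s + aeval (T.t (Fin.last n)) w := by rw [← hw]; ring
  obtain ⟨q, hq, p, rfl⟩ := T.exists_proper_add_poly (Fin.last n) (f := h)
    (by rw [K_last]; trivial)
  obtain rfl : G = r + T.D (q + aeval (T.t (Fin.last n)) p) := by rw [← hG]; ring
  obtain ⟨hle, heq⟩ := denomDegree_add_D hT.1 hs hq w p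
  rw [← hrw] at hle heq
  obtain ⟨hdeg, hlt⟩ := hlow.resolve_left (not_lt.2 hle)
  obtain rfl := heq hdeg
  rw [zero_add] at hlt
  obtain ⟨a, ha⟩ := T.exists_coe_eq_D_t hT.1 (Fin.last n)
  set W := aeval (T.t (Fin.last n)) w with hW
  set P := T.D (aeval (T.t (Fin.last n)) p) with hP
  have hzero (h0 : T.hm (r + P) < (toColex 0 : Mon n)) : r + P = 0 :=
    eq_zero_of_expansion fun _ M =>
      expansion_eq_zero_of_hm_lt (h0.trans_le (WithBot.coe_le_coe.2 (bot_le (a := M)))) _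
  -- `s` is the proper part and `W + P` the polynomial part of `r + P`.
  have hs0 (h0 : r + P = 0) : s = 0 := by
    refine (T.proper_add_poly (Fin.last n) hs.isProper (p := w + T.polyD _ a p) ?_).1
    rw [map_add, T.aeval_polyD _ ha, ← add_assoc, ← hW, ← hrw, ← hP, h0]
  have hr0 : r ≠ 0 := by
    intro h0
    rw [h0, hm_zero] at hlt
    exact not_lt_bot hlt
  obtain ⟨M, hM⟩ := WithBot.ne_bot_iff_exists.1 (mt (eq_zero_of_hm_eq_bot (T := T)) hr0)
  rw [← hM] at hlt hm
  have hsexp (i : Fin (n + 1)) (N : Mon n) (hN : N ≠ toColex 0) :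
      T.expansion r i N = T.expansion W i N := by
    rw [hrw, expansion_add, expansion_of_isCoef hs.isProper.isCoef, Pi.add_apply,
      Finsupp.add_apply, add_eq_right]
    by_cases hi : i = Fin.last n
    · subst hi
      rw [Pi.single_eq_same, Finsupp.single_eq_of_ne hN]
    · rw [Pi.single_eq_of_ne hi, Finsupp.zero_apply]
  rcases eq_or_ne W 0 with hW0 | hW0
  · -- In this case `r = s` is proper, and its head monomial is `1`.
    have hM0 : M = toColex 0 := by
      by_contra hne
      obtain ⟨i, hi⟩ := exists_expansion_ne_zero hM.symm
      rw [hsexp i M hne, hW0] at hi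
      exact hi (expansion_eq_zero_of_coef (map_zero _) i)
    rw [hM0] at hlt
    rw [hrw, hW0, add_zero] at hr0
    exact hr0 (hs0 (hzero hlt))
  · -- The proper part `s` can only contribute the lowest power product, so `r` and `W` have the
    -- same head monomial.
    have hMW : T.hm W = M := by
      obtain ⟨N, hN⟩ := WithBot.ne_bot_iff_exists.1 (mt (eq_zero_of_hm_eq_bot (T := T)) hW0)
      rw [← hN]
      congr 1
      apply le_antisymm
      · obtain ⟨i, hi⟩ := exists_expansion_ne_zero hN.symm
        have hil : i ≠ Fin.last n := by
          rintro rfl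
          rw [hw0] at hi
          exact hi rfl
        refine WithBot.coe_le_coe.1 (hM ▸ le_hm (i := i) ?_)
        rwa [hrw, expansion_add, expansion_of_isCoef hs.isProper.isCoef, Pi.add_apply,
          Finsupp.add_apply, Pi.single_eq_of_ne hil, Finsupp.zero_apply, zero_add]
      · by_cases hM0 : M = toColex 0
        · rw [hM0]
          exact bot_le (a := N)
        · obtain ⟨i, hi⟩ := exists_expansion_ne_zero hM.symm
          rw [hsexp i M hM0] at hi
          exact WithBot.coe_le_coe.1 (hN ▸ le_hm hi)
    rw [hc_eq_coef hMW] at hsimple hspan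
    have hcoef (N : Mon n) (hN : M ≤ N) : T.coef N P = -T.coef N W := by
      have h1 : T.coef N (r + P) = 0 :=
        coef_eq_zero_of_hm_lt (hlt.trans_le (WithBot.coe_le_coe.2 hN))
      have h2 : T.coef N s = 0 := by
        rw [coef_of_isCoef hs.isProper.isCoef]
        split_ifs with hN0
        · have hM0 : M = toColex 0 := le_bot_iff.1 (hN.trans_eq hN0)
          exact hs0 (hzero (hM0 ▸ hlt))
        · rfl
      rw [hrw, map_add, map_add, h2, zero_add] at h1
      exact eq_neg_of_add_eq_zero_right h1
    have hmem := coef_D_mem_span hT (Fin.last n) (aeval (T.t (Fin.last n)) p)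
      (by rw [K_last]; trivial) M (fun N hN => by
        rw [← hP, hcoef N hN.le, coef_eq_zero_of_hm_lt (hMW.trans_lt (WithBot.coe_lt_coe.2 hN)),
          neg_zero]) (by
        rw [← hP, hcoef M le_rfl, ← neg_one_smul C]
        exact (hsimple.isSquarefree hT.1).smul _)
    rw [← hP, hcoef M le_rfl] at hmem
    refine hspan ⟨coef_ne_zero_of_hm hMW, Submodule.span_mono (Set.image_mono ?_)
      ((Submodule.neg_mem_iff _).1 hmem)⟩
    rintro j ⟨hj0, -, hj⟩
    exact ⟨hj0, hm ▸ le_ind hj⟩
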